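/- **Bisimulation is a congruence (for the syndication calculus).** *Names and triples.* Fix a set of URIs, a set of literals $v$, and a binary relation $\beta$ on URIs (alias assumptions). A *name* is a URI or one of infinitely many temporary names (which stand for opened blank nodes). Variables $a$ and $x$ are place holders for names and for literals respectively. A triple $C$ has a subject and a predicate (each a name or name variable) and an object (a name, a literal or a variable). Let $\sqsubseteq$ be the reflexive transitive closure of $\beta$ on URIs and equality on temporary names and on literals, extended point-wise to variable-free triples. Constraints $\phi$ are Boolean combinations of basic predicates applied to objects; satisfaction $\vDash\phi$ is the Boolean extension of a given meaning of the basic predicates on names and literals, where this meaning is invariant under permutations of the temporary names. *Syntax.* Queries $U$ and processes $P$ are given by $$U ::= |C| \;\mid\; \phi \;\mid\; U\oplus U \;\mid\; U\otimes U \;\mid\; \textstyle\bigvee a.U \;\mid\; \bigvee x.U \;\mid\; {*}U \;\mid\; U\mathbin{;}P \qquad P ::= \bot \;\mid\; P\parallel P \;\mid\; \textstyle\bigwedge a.P \;\mid\; U \;\mid\; \underline{C}$$ (ask, filter, choice, tensor, select name, select literal, iteration, then; nothing, par, blank node, query, stored triple). $\bigvee$ and $\bigwedge$ bind their variables, and $\bigwedge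 a.P$ is also written for a temporary name $a$, meaning that $a$ is replaced by a bound variable not occurring in $P$. Let $\mathrm{fn}$ denote the set of free temporary names. *Labelled transitions.* Labels $l$ are inputs $E$ and outputs $\alpha\mid\overline{E}$, where $E$ is in the free commutative monoid $(\otimes,1)$ over variable-free triples and $\alpha$ is a finite set of (extruded) temporary names; the set of extruded names of an input is empty. Transitions are the least relation with the following rules. Below $U,V$ are queries, and processes and queries at the left of a transition have no free variables. 1. $|D|\xrightarrow{C}\bot$ if $C\sqsubseteq D$; $\ \phi\xrightarrow{1}\bot$ if $\vDash\phi$; $\ {*}U\xrightarrow{1}\bot$. 2. If $U\xrightarrow{E}Q$ then $U;P\xrightarrow{E}Q\parallel P$, $\ U\oplus V\xrightarrow{E}Q$, $\ V\oplus U\xrightarrow{E}Q$ and ${*}U\xrightarrow{E}Q$. If ${*}U\otimes{*}U\xrightarrow{E}Q$ then ${*}U\xrightarrow{E}Q$. If $U\xrightarrow{E}P$ and $V\xrightarrow{F}Q$ then $U\otimes V\xrightarrow{E\otimes F}P\parallel Q$. 3. If $U\{b/a\}\xrightarrow{E}Q$ for some name $b$ then $\bigvee a.U\xrightarrow{E}Q$.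 If $U\{v/x\}\xrightarrow{E}Q$ for some literal $v$ then $\bigvee x.U\xrightarrow{E}Q$. 4. $\underline{C}\xrightarrow{\emptyset\mid\overline{D}}\underline{C}$ if $C\sqsubseteq D$. 5. (Open) If $b$ is a temporary name, $b\notin\mathrm{fn}(P)\cup\alpha$ and $P\{b/a\}\xrightarrow{\alpha\mid\overline{E}}Q$, then $\bigwedge a.P\xrightarrow{\alpha\cup\{b\}\mid\overline{E}}Q$. 6. (Blank node context) If $b$ is a temporary name, $b\notin\mathrm{fn}(P)$, $b$ does not occur in $l$ and $P\{b/a\}\xrightarrow{l}Q$, then $\bigwedge a.P\xrightarrow{l}\bigwedge b.Q$. 7. (Par context) If $P\xrightarrow{l}P'$ and no extruded name of $l$ is in $\mathrm{fn}(Q)$, then $P\parallel Q\xrightarrow{l}P'\parallel Q$; and symmetrically. 8. (Parallel outputs) If $P\xrightarrow{\alpha_0\mid\overline{E}}P'$, $Q\xrightarrow{\alpha_1\mid\overline{F}}Q'$, and $\alpha_0\cap\alpha_1=\alpha_0\cap\mathrm{fn}(Q)=\alpha_1\cap\mathrm{fn}(P)=\emptyset$, then $P\parallel Q\xrightarrow{\alpha_0\cup\alpha_1\mid\overline{E\otimes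 F}}P'\parallel Q'$. 9. (Close) If $P\xrightarrow{E\otimes F}P'$, $Q\xrightarrow{\alpha\mid\overline{F}}Q'$ and $\alpha\cap(\mathrm{fn}(P)\cup\mathrm{fn}(E))=\emptyset$, then $P\parallel Q\xrightarrow{E}\bigwedge\alpha.(P'\parallel Q')$, where $\bigwedge\alpha$ quantifies the names of $\alpha$ in any order; and symmetrically. *Bisimulation.* On processes without free variables, $\sim$ is the greatest symmetric relation such that whenever $P\sim Q$ and $P\xrightarrow{l}P'$, where no extruded name of $l$ is in $\mathrm{fn}(P)\cup\mathrm{fn}(Q)$, there is $Q'$ with $Q\xrightarrow{l}Q'$ and $P'\sim Q'$. For processes or queries $P,Q$ that may have free variables, $P\sim Q$ means that $P\sigma\sim Q\sigma$ for every substitution $\sigma$ of names for all name variables and literals for all literal variables. *Claim.* Let $P,Q$ be both processes or both queries, and let $\mathcal{C}$ be a context, that is, a process or query with one place holder, of the syntactic category of $P$ and $Q$ (the place holder may stand at any position of the syntax above; binders of $\mathcal{C}$ may capture free variables of the term put into the place holder, and a blank node quantifier may also capture a free temporary name). If $P\sim Q$, then $\mathcal{C}[P]\sim\mathcal{C}[Q]$.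 -/

import Mathlib

namespace Syndication

/-! ### Names, literals and triples

A ground name is either a URI or a temporary name (a name standing for a blank node whose quantifier
has been opened).  There are infinitely many temporary names, and alias assumptions relate URIs only.
Variables for names and variables for literals are place holders for ground names and literals. -/

/-- Ground names: URIs and temporary names. -/
inductive GName (URI : Type*) where
  | uri (u : URI)
  | temp (a : ℕ)

/-- Ground objects: ground names and literals. -/
inductive GObj (URI Lit : Type*) where
  | name (n : GName URI)
  | lit (v : Lit)

/-- Names: ground names and name variables. -/
inductive Name (URI : Type*) where
  | ground (n : GName URI)
  | var (z : ℕ)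

/-- Objects: names, literals and literal variables. -/
inductive Obj (URI Lit : Type*) where
  | name (n : Name URI)
  | lit (v : Lit)
  | litVar (x : ℕ)

/-- Ground triples (the triples that occur on labels). -/
structure GTriple (URI Lit : Type*) where
  subj : GName URI
  pred : GName URI
  obj : GObj URI Lit

/-- Triples: literals occur only in the object position. -/
structure Triple (URI Lit : Type*) where
  subj : Name URI
  pred : Name URI
  obj : Obj URI Lit

def GObj.toObj {URI Lit : Type*} : GObj URI Lit → Obj URI Lit
  | .name n => .name (.ground n)
  | .lit v => .lit v

def GTriple.toTriple {URI Lit : Type*} (C : GTriple URI Lit) : Triple URI Lit :=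
  ⟨.ground C.subj, .ground C.pred, C.obj.toObj⟩

/-! ### The preorder generated by the alias assumptions -/

/-- The preorder over names: the reflexive transitive closure of `β` on URIs, and equality on
temporary names. -/
inductive GName.Le {URI : Type*} (β : URI → URI → Prop) : GName URI → GName URI → Prop where
  | uri {u v : URI} (h : Relation.ReflTransGen β u v) : GName.Le β (.uri u) (.uri v)
  | temp (a : ℕ) : GName.Le β (.temp a) (.temp a)

inductive GObj.Le {URI Lit : Type*} (β : URI → URI → Prop) :
    GObj URI Lit → GObj URI Lit → Prop where
  | name {m n : GName URI} (h : GName.Le β m n) : GObj.Le β (.name m) (.name n)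
  | lit (v : Lit) : GObj.Le β (.lit v) (.lit v)

/-- The preorder over triples, point-wise. -/
def GTriple.Le {URI Lit : Type*} (β : URI → URI → Prop) (C D : GTriple URI Lit) : Prop :=
  GName.Le β C.subj D.subj ∧ GName.Le β C.pred D.pred ∧ GObj.Le β C.obj D.obj

/-! ### Constraints, queries and processes -/

/-- Constraints: Boolean combinations of basic predicates applied to objects. -/
inductive Constraint (URI Lit Pred : Type*) where
  | tt
  | ff
  | or (φ ψ : Constraint URI Lit Pred)
  | and (φ ψ : Constraint URI Lit Pred)
  | not (φ : Constraint URI Lit Pred)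
  | basic (p : Pred) (args : List (Obj URI Lit))

/-- The two syntactic categories. -/
inductive Kind where
  | query
  | proc

/-- Queries `Term _ _ _ .query` and processes `Term _ _ _ .proc`.  The binders are `selectName z`,
`blank z` (both bind the name variable `z`) and `selectLit x` (binds the literal variable `x`). -/
inductive Term (URI Lit Pred : Type*) : Kind → Type _ where
  | ask (C : Triple URI Lit) : Term URI Lit Pred .query
  | filter (φ : Constraint URI Lit Pred) : Term URI Lit Pred .query
  | choice (U V : Term URI Lit Pred .query) : Term URI Lit Pred .query
  | tensor (U V : Term URI Lit Pred .query) : Term URI Lit Pred .query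
  | selectName (z : ℕ) (U : Term URI Lit Pred .query) : Term URI Lit Pred .query
  | selectLit (x : ℕ) (U : Term URI Lit Pred .query) : Term URI Lit Pred .query
  | iter (U : Term URI Lit Pred .query) : Term URI Lit Pred .query
  | andThen (U : Term URI Lit Pred .query) (P : Term URI Lit Pred .proc) :
      Term URI Lit Pred .query
  | nothing : Term URI Lit Pred .proc
  | par (P Q : Term URI Lit Pred .proc) : Term URI Lit Pred .proc
  | blank (z : ℕ) (P : Term URI Lit Pred .proc) : Term URI Lit Pred .proc
  | query (U : Term URI Lit Pred .query) : Term URI Lit Pred .proc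
  | stored (C : Triple URI Lit) : Term URI Lit Pred .proc

/-- A term regarded as a process: every query is a process. -/
def Term.toProc {URI Lit Pred : Type*} : {k : Kind} → Term URI Lit Pred k → Term URI Lit Pred .proc
  | .proc, P => P
  | .query, U => .query U

/-! ### Substitution of ground names and literals for free variables

Only ground names and literals are substituted, so that no variable can be captured; a binder
removes its variable from the domain of the substitution. -/

section Subst

variable {URI Lit Pred : Type*}

def Name.subst (σ : ℕ → Option (GName URI)) : Name URI → Name URI
  | .ground n => .ground n
  | .var z => match σ z with
    | some n => .ground n
    | none => .var z

def Obj.subst (σ : ℕ → Option (GName URI)) (τ : ℕ → Option Lit) : Obj URI Lit → Obj URI Lit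
  | .name n => .name (n.subst σ)
  | .lit v => .lit v
  | .litVar x => match τ x with
    | some v => .lit v
    | none => .litVar x

def Triple.subst (σ : ℕ → Option (GName URI)) (τ : ℕ → Option Lit) (C : Triple URI Lit) :
    Triple URI Lit :=
  ⟨C.subj.subst σ, C.pred.subst σ, C.obj.subst σ τ⟩

def Constraint.subst (σ : ℕ → Option (GName URI)) (τ : ℕ → Option Lit) :
    Constraint URI Lit Pred → Constraint URI Lit Pred
  | .tt => .tt
  | .ff => .ff
  | .or φ ψ => .or (φ.subst σ τ) (ψ.subst σ τ)
  | .and φ ψ => .and (φ.subst σ τ) (ψ.subst σ τ)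
  | .not φ => .not (φ.subst σ τ)
  | .basic p args => .basic p (args.map (Obj.subst σ τ))

def Term.subst (σ : ℕ → Option (GName URI)) (τ : ℕ → Option Lit) :
    {k : Kind} → Term URI Lit Pred k → Term URI Lit Pred k
  | _, .ask C => .ask (C.subst σ τ)
  | _, .filter φ => .filter (φ.subst σ τ)
  | _, .choice U V => .choice (U.subst σ τ) (V.subst σ τ)
  | _, .tensor U V => .tensor (U.subst σ τ) (V.subst σ τ)
  | _, .selectName z U => .selectName z (U.subst (Function.update σ z none) τ)
  | _, .selectLit x U => .selectLit x (U.subst σ (Function.update τ x none))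
  | _, .iter U => .iter (U.subst σ τ)
  | _, .andThen U P => .andThen (U.subst σ τ) (P.subst σ τ)
  | _, .nothing => .nothing
  | _, .par P Q => .par (P.subst σ τ) (Q.subst σ τ)
  | _, .blank z P => .blank z (P.subst (Function.update σ z none) τ)
  | _, .query U => .query (U.subst σ τ)
  | _, .stored C => .stored (C.subst σ τ)

/-- `P.substName z n`: the ground name `n` for the name variable `z`. -/
def Term.substName {k : Kind} (P : Term URI Lit Pred k) (z : ℕ) (n : GName URI) :
    Term URI Lit Pred k :=
  P.subst (Function.update (fun _ => none) z (some n)) (fun _ => none)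

/-- `P.substLit x v`: the literal `v` for the literal variable `x`. -/
def Term.substLit {k : Kind} (P : Term URI Lit Pred k) (x : ℕ) (v : Lit) : Term URI Lit Pred k :=
  P.subst (fun _ => none) (Function.update (fun _ => none) x (some v))

/-- Instantiate all free variables. -/
def Term.instantiate {k : Kind} (P : Term URI Lit Pred k) (σ : ℕ → GName URI) (τ : ℕ → Lit) :
    Term URI Lit Pred k :=
  P.subst (fun z => some (σ z)) (fun x => some (τ x))

/-! ### Free temporary names -/

def GName.fn : GName URI → Finset ℕ
  | .uri _ => ∅
  | .temp a => {a}

def GObj.fn : GObj URI Lit → Finset ℕ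
  | .name n => n.fn
  | .lit _ => ∅

def GTriple.fn (C : GTriple URI Lit) : Finset ℕ := C.subj.fn ∪ C.pred.fn ∪ C.obj.fn

def Name.fn : Name URI → Finset ℕ
  | .ground n => n.fn
  | .var _ => ∅

def Obj.fn : Obj URI Lit → Finset ℕ
  | .name n => n.fn
  | .lit _ => ∅
  | .litVar _ => ∅

def Triple.fn (C : Triple URI Lit) : Finset ℕ := C.subj.fn ∪ C.pred.fn ∪ C.obj.fn

def Constraint.fn : Constraint URI Lit Pred → Finset ℕ
  | .tt => ∅
  | .ff => ∅
  | .or φ ψ => φ.fn ∪ ψ.fn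
  | .and φ ψ => φ.fn ∪ ψ.fn
  | .not φ => φ.fn
  | .basic _ args => args.foldr (fun o s => o.fn ∪ s) ∅

def Term.fn : {k : Kind} → Term URI Lit Pred k → Finset ℕ
  | _, .ask C => C.fn
  | _, .filter φ => φ.fn
  | _, .choice U V => U.fn ∪ V.fn
  | _, .tensor U V => U.fn ∪ V.fn
  | _, .selectName _ U => U.fn
  | _, .selectLit _ U => U.fn
  | _, .iter U => U.fn
  | _, .andThen U P => U.fn ∪ P.fn
  | _, .nothing => ∅
  | _, .par P Q => P.fn ∪ Q.fn
  | _, .blank _ P => P.fn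
  | _, .query U => U.fn
  | _, .stored C => C.fn

/-! ### Quantifying a temporary name

`Term.hide a P` is the process `⋀ a. P`: the temporary name `a` is replaced by a name variable that
does not occur in `P`, and this variable is bound. -/

/-- Replace the temporary name `a` by the name variable `z`. -/
def Name.abstract (a z : ℕ) : Name URI → Name URI
  | .ground (.uri u) => .ground (.uri u)
  | .ground (.temp b) => if b = a then .var z else .ground (.temp b)
  | .var w => .var w

def Obj.abstract (a z : ℕ) : Obj URI Lit → Obj URI Lit
  | .name n => .name (n.abstract a z)
  | .lit v => .lit v
  | .litVar x => .litVar x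

def Triple.abstract (a z : ℕ) (C : Triple URI Lit) : Triple URI Lit :=
  ⟨C.subj.abstract a z, C.pred.abstract a z, C.obj.abstract a z⟩

def Constraint.abstract (a z : ℕ) : Constraint URI Lit Pred → Constraint URI Lit Pred
  | .tt => .tt
  | .ff => .ff
  | .or φ ψ => .or (φ.abstract a z) (ψ.abstract a z)
  | .and φ ψ => .and (φ.abstract a z) (ψ.abstract a z)
  | .not φ => .not (φ.abstract a z)
  | .basic p args => .basic p (args.map (Obj.abstract a z))

def Term.abstract (a z : ℕ) : {k : Kind} → Term URI Lit Pred k → Term URI Lit Pred k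
  | _, .ask C => .ask (C.abstract a z)
  | _, .filter φ => .filter (φ.abstract a z)
  | _, .choice U V => .choice (U.abstract a z) (V.abstract a z)
  | _, .tensor U V => .tensor (U.abstract a z) (V.abstract a z)
  | _, .selectName w U => .selectName w (U.abstract a z)
  | _, .selectLit x U => .selectLit x (U.abstract a z)
  | _, .iter U => .iter (U.abstract a z)
  | _, .andThen U P => .andThen (U.abstract a z) (P.abstract a z)
  | _, .nothing => .nothing
  | _, .par P Q => .par (P.abstract a z) (Q.abstract a z)
  | _, .blank w P => .blank w (P.abstract a z)
  | _, .query U => .query (U.abstract a z)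
  | _, .stored C => .stored (C.abstract a z)

/-- A strict upper bound for the name variables that occur, free or bound. -/
def Name.varBound : Name URI → ℕ
  | .ground _ => 0
  | .var z => z + 1

def Obj.varBound : Obj URI Lit → ℕ
  | .name n => n.varBound
  | .lit _ => 0
  | .litVar _ => 0

def Triple.varBound (C : Triple URI Lit) : ℕ :=
  max (max C.subj.varBound C.pred.varBound) C.obj.varBound

def Constraint.varBound : Constraint URI Lit Pred → ℕ
  | .tt => 0
  | .ff => 0
  | .or φ ψ => max φ.varBound ψ.varBound
  | .and φ ψ => max φ.varBound ψ.varBound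
  | .not φ => φ.varBound
  | .basic _ args => args.foldr (fun o m => max o.varBound m) 0

def Term.varBound : {k : Kind} → Term URI Lit Pred k → ℕ
  | _, .ask C => C.varBound
  | _, .filter φ => φ.varBound
  | _, .choice U V => max U.varBound V.varBound
  | _, .tensor U V => max U.varBound V.varBound
  | _, .selectName z U => max (z + 1) U.varBound
  | _, .selectLit _ U => U.varBound
  | _, .iter U => U.varBound
  | _, .andThen U P => max U.varBound P.varBound
  | _, .nothing => 0
  | _, .par P Q => max P.varBound Q.varBound
  | _, .blank z P => max (z + 1) P.varBound
  | _, .query U => U.varBound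
  | _, .stored C => C.varBound

/-- The process `⋀ a. P` for a temporary name `a`. -/
def Term.hide (a : ℕ) (P : Term URI Lit Pred .proc) : Term URI Lit Pred .proc :=
  .blank P.varBound (P.abstract a P.varBound)

/-- The process `⋀ a₁. … ⋀ aₙ. P`. -/
def Term.hideAll (as : List ℕ) (P : Term URI Lit Pred .proc) : Term URI Lit Pred .proc :=
  as.foldr Term.hide P

end Subst

/-! ### Satisfaction of constraints -/

/-- Satisfaction, given the meaning `holds` of the basic predicates on ground objects. -/
def Constraint.Sat {URI Lit Pred : Type*} (holds : Pred → List (GObj URI Lit) → Prop) :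
    Constraint URI Lit Pred → Prop
  | .tt => True
  | .ff => False
  | .or φ ψ => φ.Sat holds ∨ ψ.Sat holds
  | .and φ ψ => φ.Sat holds ∧ ψ.Sat holds
  | .not φ => ¬ φ.Sat holds
  | .basic p args => ∃ vs : List (GObj URI Lit), args = vs.map GObj.toObj ∧ holds p vs

def GObj.rename {URI Lit : Type*} (π : Equiv.Perm ℕ) : GObj URI Lit → GObj URI Lit
  | .name (.uri u) => .name (.uri u)
  | .name (.temp a) => .name (.temp (π a))
  | .lit v => .lit v

/-- The meaning of the basic predicates does not depend on the identity of temporary names. -/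
def RenamingInvariant {URI Lit Pred : Type*} (holds : Pred → List (GObj URI Lit) → Prop) : Prop :=
  ∀ (π : Equiv.Perm ℕ) (p : Pred) (vs : List (GObj URI Lit)),
    holds p (vs.map (GObj.rename π)) ↔ holds p vs

/-! ### The labelled transition system -/

/-- Labels: the free commutative monoid over ground triples is the monoid of multisets.  A label is
an input, or an output together with the finite set of extruded names. -/
inductive Label (URI Lit : Type*) where
  | input (E : Multiset (GTriple URI Lit))
  | output (α : Finset ℕ) (E : Multiset (GTriple URI Lit))

/-- The names extruded by a label. -/
def Label.extruded {URI Lit : Type*} : Label URI Lit → Finset ℕ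
  | .input _ => ∅
  | .output α _ => α

/-- The temporary names of the triples `E`. -/
def namesOf {URI Lit : Type*} (E : Multiset (GTriple URI Lit)) : Set ℕ :=
  {a | ∃ C ∈ E, a ∈ C.fn}

/-- All names of a label, extruded or not. -/
def Label.names {URI Lit : Type*} : Label URI Lit → Set ℕ
  | .input E => namesOf E
  | .output α E => ↑α ∪ namesOf E

section LTS

variable {URI Lit Pred : Type*} (β : URI → URI → Prop)
  (holds : Pred → List (GObj URI Lit) → Prop)

/-- Labelled transitions of queries; all are inputs. -/
inductive QStep : Term URI Lit Pred .query → Multiset (GTriple URI Lit) →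
    Term URI Lit Pred .proc → Prop where
  | ask {C D : GTriple URI Lit} (h : GTriple.Le β C D) : QStep (.ask D.toTriple) {C} .nothing
  | andThen {U : Term URI Lit Pred .query} {P Q : Term URI Lit Pred .proc}
      {E : Multiset (GTriple URI Lit)} (h : QStep U E Q) : QStep (.andThen U P) E (.par Q P)
  | tensor {U V : Term URI Lit Pred .query} {P Q : Term URI Lit Pred .proc}
      {E F : Multiset (GTriple URI Lit)} (hU : QStep U E P) (hV : QStep V F Q) :
      QStep (.tensor U V) (E + F) (.par P Q)
  | choiceLeft {U V : Term URI Lit Pred .query} {P : Term URI Lit Pred .proc}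
      {E : Multiset (GTriple URI Lit)} (h : QStep U E P) : QStep (.choice U V) E P
  | choiceRight {U V : Term URI Lit Pred .query} {Q : Term URI Lit Pred .proc}
      {E : Multiset (GTriple URI Lit)} (h : QStep V E Q) : QStep (.choice U V) E Q
  | filter {φ : Constraint URI Lit Pred} (h : φ.Sat holds) : QStep (.filter φ) 0 .nothing
  | selectName {z : ℕ} {U : Term URI Lit Pred .query} {Q : Term URI Lit Pred .proc}
      {E : Multiset (GTriple URI Lit)} (n : GName URI) (h : QStep (U.substName z n) E Q) :
      QStep (.selectName z U) E Q
  | selectLit {x : ℕ} {U : Term URI Lit Pred .query} {Q : Term URI Lit Pred .proc}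
      {E : Multiset (GTriple URI Lit)} (v : Lit) (h : QStep (U.substLit x v) E Q) :
      QStep (.selectLit x U) E Q
  | weakening {U : Term URI Lit Pred .query} : QStep (.iter U) 0 .nothing
  | dereliction {U : Term URI Lit Pred .query} {P : Term URI Lit Pred .proc}
      {E : Multiset (GTriple URI Lit)} (h : QStep U E P) : QStep (.iter U) E P
  | contraction {U : Term URI Lit Pred .query} {P : Term URI Lit Pred .proc}
      {E : Multiset (GTriple URI Lit)} (h : QStep (.tensor (.iter U) (.iter U)) E P) :
      QStep (.iter U) E P

/-- Labelled transitions of processes.  In `openScope` and `blankContext` the quantified variable is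
represented by a temporary name `a` that is not free in the process (alpha conversion). -/
inductive Step : Term URI Lit Pred .proc → Label URI Lit → Term URI Lit Pred .proc → Prop where
  | query {U : Term URI Lit Pred .query} {E : Multiset (GTriple URI Lit)}
      {P : Term URI Lit Pred .proc} (h : QStep β holds U E P) : Step (.query U) (.input E) P
  | stored {C D : GTriple URI Lit} (h : GTriple.Le β C D) :
      Step (.stored C.toTriple) (.output ∅ {D}) (.stored C.toTriple)
  | openScope {z a : ℕ} {P Q : Term URI Lit Pred .proc} {α : Finset ℕ}
      {E : Multiset (GTriple URI Lit)} (hP : a ∉ P.fn) (hα : a ∉ α)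
      (h : Step (P.substName z (.temp a)) (.output α E) Q) :
      Step (.blank z P) (.output (insert a α) E) Q
  | blankContext {z a : ℕ} {P Q : Term URI Lit Pred .proc} {l : Label URI Lit}
      (hP : a ∉ P.fn) (hl : a ∉ l.names) (h : Step (P.substName z (.temp a)) l Q) :
      Step (.blank z P) l (.hide a Q)
  | parLeft {P P' Q : Term URI Lit Pred .proc} {l : Label URI Lit}
      (hQ : Disjoint l.extruded Q.fn) (h : Step P l P') : Step (.par P Q) l (.par P' Q)
  | parRight {P Q Q' : Term URI Lit Pred .proc} {l : Label URI Lit}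
      (hP : Disjoint l.extruded P.fn) (h : Step Q l Q') : Step (.par P Q) l (.par P Q')
  | parOutputs {P P' Q Q' : Term URI Lit Pred .proc} {α₀ α₁ : Finset ℕ}
      {E F : Multiset (GTriple URI Lit)} (hα : Disjoint α₀ α₁) (hQ : Disjoint α₀ Q.fn)
      (hP : Disjoint α₁ P.fn) (h₀ : Step P (.output α₀ E) P') (h₁ : Step Q (.output α₁ F) Q') :
      Step (.par P Q) (.output (α₀ ∪ α₁) (E + F)) (.par P' Q')
  | closeLeft {P P' Q Q' : Term URI Lit Pred .proc} {as : List ℕ}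
      {E F : Multiset (GTriple URI Lit)} (has : as.Nodup)
      (hα : ∀ a ∈ as, a ∉ P.fn ∧ a ∉ namesOf E) (h₀ : Step P (.input (E + F)) P')
      (h₁ : Step Q (.output as.toFinset F) Q') :
      Step (.par P Q) (.input E) (.hideAll as (.par P' Q'))
  | closeRight {P P' Q Q' : Term URI Lit Pred .proc} {as : List ℕ}
      {E F : Multiset (GTriple URI Lit)} (has : as.Nodup)
      (hα : ∀ a ∈ as, a ∉ Q.fn ∧ a ∉ namesOf E) (h₀ : Step P (.output as.toFinset F) P')
      (h₁ : Step Q (.input (E + F)) Q') :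
      Step (.par P Q) (.input E) (.hideAll as (.par P' Q'))

/-! ### Bisimulation -/

/-- A bisimulation.  Extruded names are bound, hence taken fresh for both processes. -/
def IsBisimulation (R : Term URI Lit Pred .proc → Term URI Lit Pred .proc → Prop) : Prop :=
  (∀ P Q, R P Q → R Q P) ∧
  ∀ P Q, R P Q → ∀ (l : Label URI Lit) (P' : Term URI Lit Pred .proc),
    Disjoint l.extruded (P.fn ∪ Q.fn) → Step β holds P l P' →
      ∃ Q', Step β holds Q l Q' ∧ R P' Q'

/-- The greatest bisimulation, on processes without free variables. -/
def ClosedBisimilar (P Q : Term URI Lit Pred .proc) : Prop :=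
  ∃ R, IsBisimulation β holds R ∧ R P Q

/-- Bisimilarity of terms that may have free variables: all their instances are bisimilar. -/
def Bisimilar {k : Kind} (P Q : Term URI Lit Pred k) : Prop :=
  ∀ (σ : ℕ → GName URI) (τ : ℕ → Lit),
    ClosedBisimilar β holds (P.instantiate σ τ).toProc (Q.instantiate σ τ).toProc

end LTS

/-! ### Contexts -/

/-- `Ctx _ _ _ h k`: contexts of category `k` with one place holder for a term of category `h`.
The binders capture the free variables of the term that is put in; `blankName a` quantifies a free
temporary name of that term. -/
inductive Ctx (URI Lit Pred : Type*) (h : Kind) : Kind → Type _ where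
  | hole : Ctx URI Lit Pred h h
  | choiceLeft (C : Ctx URI Lit Pred h .query) (V : Term URI Lit Pred .query) :
      Ctx URI Lit Pred h .query
  | choiceRight (U : Term URI Lit Pred .query) (C : Ctx URI Lit Pred h .query) :
      Ctx URI Lit Pred h .query
  | tensorLeft (C : Ctx URI Lit Pred h .query) (V : Term URI Lit Pred .query) :
      Ctx URI Lit Pred h .query
  | tensorRight (U : Term URI Lit Pred .query) (C : Ctx URI Lit Pred h .query) :
      Ctx URI Lit Pred h .query
  | selectName (z : ℕ) (C : Ctx URI Lit Pred h .query) : Ctx URI Lit Pred h .query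
  | selectLit (x : ℕ) (C : Ctx URI Lit Pred h .query) : Ctx URI Lit Pred h .query
  | iter (C : Ctx URI Lit Pred h .query) : Ctx URI Lit Pred h .query
  | andThenLeft (C : Ctx URI Lit Pred h .query) (P : Term URI Lit Pred .proc) :
      Ctx URI Lit Pred h .query
  | andThenRight (U : Term URI Lit Pred .query) (C : Ctx URI Lit Pred h .proc) :
      Ctx URI Lit Pred h .query
  | parLeft (C : Ctx URI Lit Pred h .proc) (Q : Term URI Lit Pred .proc) : Ctx URI Lit Pred h .proc
  | parRight (P : Term URI Lit Pred .proc) (C : Ctx URI Lit Pred h .proc) : Ctx URI Lit Pred h .proc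
  | blank (z : ℕ) (C : Ctx URI Lit Pred h .proc) : Ctx URI Lit Pred h .proc
  | blankName (a : ℕ) (C : Ctx URI Lit Pred h .proc) : Ctx URI Lit Pred h .proc
  | query (C : Ctx URI Lit Pred h .query) : Ctx URI Lit Pred h .proc

/-- Put a term into the place holder of a context. -/
def Ctx.plug {URI Lit Pred : Type*} {h : Kind} :
    {k : Kind} → Ctx URI Lit Pred h k → Term URI Lit Pred h → Term URI Lit Pred k
  | _, .hole, T => T
  | _, .choiceLeft C V, T => .choice (C.plug T) V
  | _, .choiceRight U C, T => .choice U (C.plug T)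
  | _, .tensorLeft C V, T => .tensor (C.plug T) V
  | _, .tensorRight U C, T => .tensor U (C.plug T)
  | _, .selectName z C, T => .selectName z (C.plug T)
  | _, .selectLit x C, T => .selectLit x (C.plug T)
  | _, .iter C, T => .iter (C.plug T)
  | _, .andThenLeft C P, T => .andThen (C.plug T) P
  | _, .andThenRight U C, T => .andThen U (C.plug T)
  | _, .parLeft C Q, T => .par (C.plug T) Q
  | _, .parRight P C, T => .par P (C.plug T)
  | _, .blank z C, T => .blank z (C.plug T)
  | _, .blankName a C, T => .hide a (C.plug T)
  | _, .query C, T => .query (C.plug T)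

end Syndication

/-! Close bisimilarity under all operators of the syntax, which gives `Cong`, and show that this
closure is itself a bisimulation; it is then contained in the greatest one. Binders are treated
through instances of their bodies: all names or literals for the two selections, fresh temporary
names for blank nodes. Capture by a context is therefore harmless: below a binder the induction on
the context continues with a changed instantiation, and the hypothesis is available for every
instantiation (`Cong.instantiate_plug`).

Related terms match each other's transitions (`Cong.simulates`) by induction on the closure and
inversion of the rules. Two points are not immediate. Contraction turns an iteration into a larger
query, so `Simulates.iter` inducts on the derivation of the transition. And a name that is closed by
a communication, or opened below a quantifier, is fresh for one of the two related processes but may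
be free in the other. Transitions are equivariant under permutations of the temporary names
(`Step.rename`, which uses the invariance of the basic predicates), so such a transition can be
replayed with names fresh for both sides and with literally the same target
(`Step.exists_fresh_close`, `Step.exists_fresh_blankContext`).

These targets quantify temporary names, so the closure must be stable under `hide`. Abstracting `a`
and instantiating with a fresh `b` amounts to swapping `a` and `b` (`Term.abstract_subst`);
stability (`Cong.hide`) thus reduces to equivariance of the closure, which rests on that of
bisimilarity (`ClosedBisimilar.rename`). -/

namespace Syndication

/-! ### Syntax: the calculus of renaming, substitution and abstraction. -/

section Renaming

variable {URI Lit Pred : Type*}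

/-! ### Renaming of temporary names -/

/-- Permutations instead of arbitrary maps: freshness conditions survive, and every renaming can be
undone. -/
def GName.rename (π : Equiv.Perm ℕ) : GName URI → GName URI
  | .uri u => .uri u
  | .temp a => .temp (π a)

def GTriple.rename (π : Equiv.Perm ℕ) (C : GTriple URI Lit) : GTriple URI Lit :=
  ⟨C.subj.rename π, C.pred.rename π, C.obj.rename π⟩

def Name.rename (π : Equiv.Perm ℕ) : Name URI → Name URI
  | .ground n => .ground (n.rename π)
  | .var z => .var z

def Obj.rename (π : Equiv.Perm ℕ) : Obj URI Lit → Obj URI Lit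
  | .name n => .name (n.rename π)
  | .lit v => .lit v
  | .litVar x => .litVar x

def Triple.rename (π : Equiv.Perm ℕ) (C : Triple URI Lit) : Triple URI Lit :=
  ⟨C.subj.rename π, C.pred.rename π, C.obj.rename π⟩

def Constraint.rename (π : Equiv.Perm ℕ) : Constraint URI Lit Pred → Constraint URI Lit Pred
  | .tt => .tt
  | .ff => .ff
  | .or φ ψ => .or (φ.rename π) (ψ.rename π)
  | .and φ ψ => .and (φ.rename π) (ψ.rename π)
  | .not φ => .not (φ.rename π)
  | .basic p args => .basic p (args.map (Obj.rename π))

def Term.rename (π : Equiv.Perm ℕ) : {k : Kind} → Term URI Lit Pred k → Term URI Lit Pred k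
  | _, .ask C => .ask (C.rename π)
  | _, .filter φ => .filter (φ.rename π)
  | _, .choice U V => .choice (U.rename π) (V.rename π)
  | _, .tensor U V => .tensor (U.rename π) (V.rename π)
  | _, .selectName w U => .selectName w (U.rename π)
  | _, .selectLit x U => .selectLit x (U.rename π)
  | _, .iter U => .iter (U.rename π)
  | _, .andThen U P => .andThen (U.rename π) (P.rename π)
  | _, .nothing => .nothing
  | _, .par P Q => .par (P.rename π) (Q.rename π)
  | _, .blank w P => .blank w (P.rename π)
  | _, .query U => .query (U.rename π)
  | _, .stored C => .stored (C.rename π)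

def Label.rename (π : Equiv.Perm ℕ) : Label URI Lit → Label URI Lit
  | .input E => .input (E.map (GTriple.rename π))
  | .output α E => .output (α.image π) (E.map (GTriple.rename π))

@[simp] theorem GObj.rename_name (π : Equiv.Perm ℕ) (n : GName URI) :
    GObj.rename π (.name n : GObj URI Lit) = .name (n.rename π) := by
  cases n <;> rfl

@[simp] theorem GObj.rename_lit (π : Equiv.Perm ℕ) (v : Lit) :
    GObj.rename π (.lit v : GObj URI Lit) = .lit v := rfl

@[simp] theorem GObj.toObj_rename (π : Equiv.Perm ℕ) (o : GObj URI Lit) :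
    (o.rename π).toObj = o.toObj.rename π := by
  cases o <;> simp [GObj.toObj, Obj.rename, Name.rename]

theorem GTriple.toTriple_rename (π : Equiv.Perm ℕ) (C : GTriple URI Lit) :
    (C.rename π).toTriple = C.toTriple.rename π := by
  simp [GTriple.toTriple, GTriple.rename, Triple.rename, Name.rename]

/-! ### Membership in the free names and bounds on the variables of a list of arguments -/

theorem Constraint.mem_fn_basic {p : Pred} {args : List (Obj URI Lit)} {b : ℕ} :
    b ∈ (Constraint.basic p args).fn ↔ ∃ o ∈ args, b ∈ o.fn := by
  induction args with
  | nil => simp [Constraint.fn]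
  | cons o l ih =>
    simp only [Constraint.fn] at ih
    simp [Constraint.fn, ih]

theorem Constraint.varBound_basic_le {p : Pred} {args : List (Obj URI Lit)} {z : ℕ} :
    (Constraint.basic p args).varBound ≤ z ↔ ∀ o ∈ args, o.varBound ≤ z := by
  induction args with
  | nil => simp [Constraint.varBound]
  | cons o l ih =>
    simp only [Constraint.varBound] at ih
    simp [Constraint.varBound, ih]

/-! ### A renaming that fixes the free names is the identity -/

theorem GName.rename_of_fixed {π : Equiv.Perm ℕ} {n : GName URI} (h : ∀ a ∈ n.fn, π a = a) :
    n.rename π = n := by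
  cases n <;> simp_all [GName.rename, GName.fn]

theorem GTriple.rename_of_fixed {π : Equiv.Perm ℕ} {C : GTriple URI Lit}
    (h : ∀ a ∈ C.fn, π a = a) : C.rename π = C := by
  rcases C with ⟨s, p, o⟩
  simp only [GTriple.fn, Finset.mem_union] at h
  have ho : o.rename π = o := by
    cases o with
    | name n =>
      rw [GObj.rename_name, GName.rename_of_fixed fun a ha => h a (Or.inr ha)]
    | lit v => rfl
  simp only [GTriple.rename, ho]
  rw [GName.rename_of_fixed fun a ha => h a (.inl (.inl ha)),
    GName.rename_of_fixed fun a ha => h a (.inl (.inr ha))]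

theorem Name.rename_of_fixed {π : Equiv.Perm ℕ} {n : Name URI} (h : ∀ a ∈ n.fn, π a = a) :
    n.rename π = n := by
  cases n with
  | ground n => rw [Name.rename, GName.rename_of_fixed h]
  | var z => rfl

theorem Obj.rename_of_fixed {π : Equiv.Perm ℕ} {o : Obj URI Lit} (h : ∀ a ∈ o.fn, π a = a) :
    o.rename π = o := by
  cases o with
  | name n => rw [Obj.rename, Name.rename_of_fixed h]
  | lit v => rfl
  | litVar x => rfl

theorem Triple.rename_of_fixed {π : Equiv.Perm ℕ} {C : Triple URI Lit}
    (h : ∀ a ∈ C.fn, π a = a) : C.rename π = C := by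
  rcases C with ⟨s, p, o⟩
  simp only [Triple.fn, Finset.mem_union] at h
  simp only [Triple.rename]
  rw [Name.rename_of_fixed fun a ha => h a (.inl (.inl ha)),
    Name.rename_of_fixed fun a ha => h a (.inl (.inr ha)),
    Obj.rename_of_fixed fun a ha => h a (.inr ha)]

theorem Constraint.rename_of_fixed {π : Equiv.Perm ℕ} {φ : Constraint URI Lit Pred}
    (h : ∀ a ∈ φ.fn, π a = a) : φ.rename π = φ := by
  induction φ with
  | basic p args =>
    rw [Constraint.rename, List.map_congr_left (g := id), List.map_id]
    exact fun o ho => Obj.rename_of_fixed fun a ha => h a (Constraint.mem_fn_basic.2 ⟨o, ho, ha⟩)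
  | _ => simp_all [Constraint.fn, Constraint.rename]

/-- Bound positions hold variables, on which a renaming does not act, so binders impose no
condition. This turns freshness arguments into equalities of terms. -/
theorem Term.rename_of_fixed {π : Equiv.Perm ℕ} {k : Kind} {P : Term URI Lit Pred k}
    (h : ∀ a ∈ P.fn, π a = a) : P.rename π = P := by
  induction P with
  | ask C => rw [Term.rename, Triple.rename_of_fixed h]
  | stored C => rw [Term.rename, Triple.rename_of_fixed h]
  | filter φ => rw [Term.rename, Constraint.rename_of_fixed h]
  | _ => simp_all [Term.fn, Term.rename]

/-! ### Composition of renamings -/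

theorem GName.rename_rename (π ρ : Equiv.Perm ℕ) (n : GName URI) :
    (n.rename ρ).rename π = n.rename (π * ρ) := by
  cases n <;> rfl

theorem Obj.rename_rename (π ρ : Equiv.Perm ℕ) (o : Obj URI Lit) :
    (o.rename ρ).rename π = o.rename (π * ρ) := by
  rcases o with (n | z) | v | x <;> simp [Obj.rename, Name.rename, GName.rename_rename]

theorem Triple.rename_rename (π ρ : Equiv.Perm ℕ) (C : Triple URI Lit) :
    (C.rename ρ).rename π = C.rename (π * ρ) := by
  rcases C with ⟨_ | _, _ | _, _⟩ <;>
    simp [Triple.rename, Name.rename, GName.rename_rename, Obj.rename_rename]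

theorem GTriple.rename_rename (π ρ : Equiv.Perm ℕ) (C : GTriple URI Lit) :
    (C.rename ρ).rename π = C.rename (π * ρ) := by
  rcases C with ⟨_, _, _ | _⟩ <;> simp [GTriple.rename, GName.rename_rename]

theorem Constraint.rename_rename (π ρ : Equiv.Perm ℕ) (φ : Constraint URI Lit Pred) :
    (φ.rename ρ).rename π = φ.rename (π * ρ) := by
  induction φ <;> simp_all [Constraint.rename, Obj.rename_rename]

theorem Term.rename_rename (π ρ : Equiv.Perm ℕ) {k : Kind} (P : Term URI Lit Pred k) :
    (P.rename ρ).rename π = P.rename (π * ρ) := by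
  induction P <;> simp_all [Term.rename, Triple.rename_rename, Constraint.rename_rename]

theorem Term.rename_one {k : Kind} (P : Term URI Lit Pred k) : P.rename 1 = P :=
  Term.rename_of_fixed fun _ _ => rfl

theorem Obj.rename_inv_rename (π : Equiv.Perm ℕ) (o : Obj URI Lit) :
    (o.rename π).rename π⁻¹ = o := by
  rw [Obj.rename_rename, inv_mul_cancel]
  exact Obj.rename_of_fixed fun _ _ => rfl

theorem Term.rename_inv_rename (π : Equiv.Perm ℕ) {k : Kind} (P : Term URI Lit Pred k) :
    (P.rename π).rename π⁻¹ = P := by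
  rw [Term.rename_rename, inv_mul_cancel, Term.rename_one]

theorem Term.rename_rename_inv (π : Equiv.Perm ℕ) {k : Kind} (P : Term URI Lit Pred k) :
    (P.rename π⁻¹).rename π = P := by
  rw [Term.rename_rename, mul_inv_cancel, Term.rename_one]

theorem GTriple.rename_inv_rename (π : Equiv.Perm ℕ) (C : GTriple URI Lit) :
    (C.rename π).rename π⁻¹ = C := by
  rw [GTriple.rename_rename, inv_mul_cancel]
  exact GTriple.rename_of_fixed fun _ _ => rfl

theorem GTriple.rename_rename_inv (π : Equiv.Perm ℕ) (C : GTriple URI Lit) :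
    (C.rename π⁻¹).rename π = C := by
  simpa using GTriple.rename_inv_rename π⁻¹ C

theorem Label.rename_rename_inv (π : Equiv.Perm ℕ) (l : Label URI Lit) :
    (l.rename π⁻¹).rename π = l := by
  cases l with
  | input E => simp [Label.rename, GTriple.rename_rename_inv]
  | output α E => simp [Label.rename, GTriple.rename_rename_inv, Finset.image_image]

/-! ### Renaming and free names -/

theorem GName.fn_rename (π : Equiv.Perm ℕ) (n : GName URI) : (n.rename π).fn = n.fn.image π := by
  cases n <;> simp [GName.rename, GName.fn]

theorem Name.fn_rename (π : Equiv.Perm ℕ) (n : Name URI) : (n.rename π).fn = n.fn.image π := by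
  cases n <;> simp [Name.rename, Name.fn, GName.fn_rename]

theorem Obj.fn_rename (π : Equiv.Perm ℕ) (o : Obj URI Lit) : (o.rename π).fn = o.fn.image π := by
  cases o <;> simp [Obj.rename, Obj.fn, Name.fn_rename]

theorem GTriple.fn_rename (π : Equiv.Perm ℕ) (C : GTriple URI Lit) :
    (C.rename π).fn = C.fn.image π := by
  rcases C with ⟨_, _, _ | _⟩ <;>
    simp [GTriple.rename, GTriple.fn, GObj.fn, GName.fn_rename, Finset.image_union]

theorem Triple.fn_rename (π : Equiv.Perm ℕ) (C : Triple URI Lit) :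
    (C.rename π).fn = C.fn.image π := by
  simp [Triple.rename, Triple.fn, Obj.fn_rename, Name.fn_rename, Finset.image_union]

theorem Constraint.fn_rename (π : Equiv.Perm ℕ) (φ : Constraint URI Lit Pred) :
    (φ.rename π).fn = φ.fn.image π := by
  induction φ with
  | basic p args =>
    ext b
    simp only [Constraint.rename, Constraint.mem_fn_basic, Finset.mem_image, List.mem_map]
    constructor
    · rintro ⟨_, ⟨o, ho, rfl⟩, hb⟩
      rw [Obj.fn_rename, Finset.mem_image] at hb
      obtain ⟨a, ha, rfl⟩ := hb
      exact ⟨a, ⟨o, ho, ha⟩, rfl⟩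
    · rintro ⟨a, ⟨o, ho, ha⟩, rfl⟩
      exact ⟨_, ⟨o, ho, rfl⟩, by rw [Obj.fn_rename]; exact Finset.mem_image_of_mem _ ha⟩
  | _ => simp_all [Constraint.rename, Constraint.fn, Finset.image_union]

theorem Term.fn_rename (π : Equiv.Perm ℕ) {k : Kind} (P : Term URI Lit Pred k) :
    (P.rename π).fn = P.fn.image π := by
  induction P <;>
    simp_all [Term.rename, Term.fn, Triple.fn_rename, Constraint.fn_rename, Finset.image_union]

theorem Term.mem_fn_rename {π : Equiv.Perm ℕ} {k : Kind} {P : Term URI Lit Pred k} {a : ℕ} :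
    π a ∈ (P.rename π).fn ↔ a ∈ P.fn := by
  simp [Term.fn_rename]

theorem mem_namesOf_rename {π : Equiv.Perm ℕ} {E : Multiset (GTriple URI Lit)} {a : ℕ} :
    π a ∈ namesOf (E.map (GTriple.rename π)) ↔ a ∈ namesOf E := by
  simp [namesOf, GTriple.fn_rename]

theorem Label.mem_names_rename {π : Equiv.Perm ℕ} {l : Label URI Lit} {a : ℕ} :
    π a ∈ (l.rename π).names ↔ a ∈ l.names := by
  cases l <;> simp [Label.names, Label.rename, mem_namesOf_rename]

theorem Label.extruded_rename (π : Equiv.Perm ℕ) (l : Label URI Lit) :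
    (l.rename π).extruded = l.extruded.image π := by
  cases l <;> simp [Label.extruded, Label.rename]

theorem namesOf_finite (E : Multiset (GTriple URI Lit)) : (namesOf E).Finite := by
  have : namesOf E = ⋃ C ∈ {C | C ∈ E}, (C.fn : Set ℕ) := by
    ext a
    simp [namesOf]
  rw [this]
  exact (Multiset.finite_toSet E).biUnion fun C _ => C.fn.finite_toSet

theorem Label.names_finite (l : Label URI Lit) : l.names.Finite := by
  cases l with
  | input E => exact namesOf_finite E
  | output α E => exact α.finite_toSet.union (namesOf_finite E)

theorem map_rename_of_fixed {π : Equiv.Perm ℕ} {E : Multiset (GTriple URI Lit)}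
    (h : ∀ a ∈ namesOf E, π a = a) : E.map (GTriple.rename π) = E := by
  conv_rhs => rw [← Multiset.map_id E]
  exact Multiset.map_congr rfl fun C hC => GTriple.rename_of_fixed fun a ha => h a ⟨C, hC, ha⟩

theorem Label.rename_of_fixed {π : Equiv.Perm ℕ} {l : Label URI Lit}
    (h : ∀ a ∈ l.names, π a = a) : l.rename π = l := by
  cases l with
  | input E => rw [Label.rename, map_rename_of_fixed h]
  | output α E =>
    rw [Label.rename, map_rename_of_fixed fun a ha => h a (Or.inr ha),
      Finset.image_congr (g := id), Finset.image_id]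
    exact fun a ha => h a (Or.inl ha)

/-! ### Renaming commutes with substitution and abstraction -/

theorem Name.rename_subst (π : Equiv.Perm ℕ) (σ : ℕ → Option (GName URI)) (n : Name URI) :
    (n.subst σ).rename π = (n.rename π).subst (fun z => (σ z).map (GName.rename π)) := by
  cases n with
  | ground n => rfl
  | var z => cases h : σ z <;> simp [Name.subst, Name.rename, h]

theorem Obj.rename_subst (π : Equiv.Perm ℕ) (σ : ℕ → Option (GName URI)) (τ : ℕ → Option Lit)
    (o : Obj URI Lit) :
    (o.subst σ τ).rename π = (o.rename π).subst (fun z => (σ z).map (GName.rename π)) τ := by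
  cases o with
  | name n => simp [Obj.subst, Obj.rename, Name.rename_subst]
  | lit v => rfl
  | litVar x => cases h : τ x <;> simp [Obj.subst, Obj.rename, h]

theorem Triple.rename_subst (π : Equiv.Perm ℕ) (σ : ℕ → Option (GName URI)) (τ : ℕ → Option Lit)
    (C : Triple URI Lit) :
    (C.subst σ τ).rename π = (C.rename π).subst (fun z => (σ z).map (GName.rename π)) τ := by
  simp [Triple.subst, Triple.rename, Name.rename_subst, Obj.rename_subst]

theorem Constraint.rename_subst (π : Equiv.Perm ℕ) (σ : ℕ → Option (GName URI))
    (τ : ℕ → Option Lit) (φ : Constraint URI Lit Pred) :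
    (φ.subst σ τ).rename π = (φ.rename π).subst (fun z => (σ z).map (GName.rename π)) τ := by
  induction φ <;> simp_all [Constraint.subst, Constraint.rename, Obj.rename_subst]

theorem map_update_none (f : GName URI → GName URI) (σ : ℕ → Option (GName URI)) (z : ℕ) :
    (fun w => (Function.update σ z none w).map f) =
      Function.update (fun w => (σ w).map f) z none := by
  funext w
  by_cases h : w = z <;> simp [Function.update, h]

theorem Term.rename_subst (π : Equiv.Perm ℕ) (σ : ℕ → Option (GName URI)) (τ : ℕ → Option Lit)
    {k : Kind} (P : Term URI Lit Pred k) :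
    (P.subst σ τ).rename π = (P.rename π).subst (fun z => (σ z).map (GName.rename π)) τ := by
  induction P generalizing σ τ <;>
    simp_all [Term.subst, Term.rename, Triple.rename_subst, Constraint.rename_subst,
      map_update_none]

theorem Term.rename_substName (π : Equiv.Perm ℕ) {k : Kind} (P : Term URI Lit Pred k) (z : ℕ)
    (n : GName URI) : (P.substName z n).rename π = (P.rename π).substName z (n.rename π) := by
  rw [Term.substName, Term.rename_subst, Term.substName]
  congr 1
  funext w
  by_cases h : w = z <;> simp [Function.update, h]

theorem Term.rename_substLit (π : Equiv.Perm ℕ) {k : Kind} (P : Term URI Lit Pred k) (x : ℕ)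
    (v : Lit) : (P.substLit x v).rename π = (P.rename π).substLit x v := by
  rw [Term.substLit, Term.rename_subst, Term.substLit]
  rfl

theorem Term.rename_instantiate (π : Equiv.Perm ℕ) {k : Kind} (P : Term URI Lit Pred k)
    (σ : ℕ → GName URI) (τ : ℕ → Lit) :
    (P.instantiate σ τ).rename π = (P.rename π).instantiate (fun z => (σ z).rename π) τ := by
  rw [Term.instantiate, Term.rename_subst, Term.instantiate]
  rfl

theorem Name.rename_abstract (π : Equiv.Perm ℕ) (a z : ℕ) (n : Name URI) :
    (n.abstract a z).rename π = (n.rename π).abstract (π a) z := by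
  rcases n with (u | b) | w
  · rfl
  · by_cases h : b = a <;> simp [Name.abstract, Name.rename, GName.rename, h]
  · rfl

theorem Obj.rename_abstract (π : Equiv.Perm ℕ) (a z : ℕ) (o : Obj URI Lit) :
    (o.abstract a z).rename π = (o.rename π).abstract (π a) z := by
  cases o <;> simp [Obj.abstract, Obj.rename, Name.rename_abstract]

theorem Triple.rename_abstract (π : Equiv.Perm ℕ) (a z : ℕ) (C : Triple URI Lit) :
    (C.abstract a z).rename π = (C.rename π).abstract (π a) z := by
  simp [Triple.abstract, Triple.rename, Name.rename_abstract, Obj.rename_abstract]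

theorem Constraint.rename_abstract (π : Equiv.Perm ℕ) (a z : ℕ) (φ : Constraint URI Lit Pred) :
    (φ.abstract a z).rename π = (φ.rename π).abstract (π a) z := by
  induction φ <;> simp_all [Constraint.abstract, Constraint.rename, Obj.rename_abstract]

theorem Term.rename_abstract (π : Equiv.Perm ℕ) (a z : ℕ) {k : Kind} (P : Term URI Lit Pred k) :
    (P.abstract a z).rename π = (P.rename π).abstract (π a) z := by
  induction P <;>
    simp_all [Term.abstract, Term.rename, Triple.rename_abstract, Constraint.rename_abstract]

theorem Name.varBound_rename (π : Equiv.Perm ℕ) (n : Name URI) :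
    (n.rename π).varBound = n.varBound := by
  cases n <;> rfl

theorem Obj.varBound_rename (π : Equiv.Perm ℕ) (o : Obj URI Lit) :
    (o.rename π).varBound = o.varBound := by
  cases o <;> simp [Obj.rename, Obj.varBound, Name.varBound_rename]

theorem Triple.varBound_rename (π : Equiv.Perm ℕ) (C : Triple URI Lit) :
    (C.rename π).varBound = C.varBound := by
  simp [Triple.rename, Triple.varBound, Name.varBound_rename, Obj.varBound_rename]

theorem Constraint.varBound_rename (π : Equiv.Perm ℕ) (φ : Constraint URI Lit Pred) :
    (φ.rename π).varBound = φ.varBound := by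
  induction φ <;>
    simp_all [Constraint.rename, Constraint.varBound, Obj.varBound_rename, List.foldr_map]

theorem Term.varBound_rename (π : Equiv.Perm ℕ) {k : Kind} (P : Term URI Lit Pred k) :
    (P.rename π).varBound = P.varBound := by
  induction P <;>
    simp_all [Term.rename, Term.varBound, Triple.varBound_rename, Constraint.varBound_rename]

/-- The variable chosen by `hide` depends only on `varBound`, which a renaming preserves; hence an
equality and not just an alpha equivalence. -/
theorem Term.rename_hide (π : Equiv.Perm ℕ) (a : ℕ) (P : Term URI Lit Pred .proc) :
    (P.hide a).rename π = (P.rename π).hide (π a) := by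
  simp [Term.hide, Term.rename, Term.rename_abstract, Term.varBound_rename]

theorem Term.rename_hideAll (π : Equiv.Perm ℕ) (as : List ℕ) (P : Term URI Lit Pred .proc) :
    (P.hideAll as).rename π = (P.rename π).hideAll (as.map π) := by
  induction as with
  | nil => rfl
  | cons a as ih =>
    simp only [Term.hideAll, List.foldr_cons, List.map_cons] at ih ⊢
    rw [Term.rename_hide, ih]

/-! ### Free names of abstractions and substitution instances -/

theorem Name.fn_abstract (a z : ℕ) (n : Name URI) : (n.abstract a z).fn = n.fn.erase a := by
  rcases n with (u | b) | w
  · rfl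
  · by_cases h : b = a
    · simp [Name.abstract, Name.fn, GName.fn, h]
    · simp [Name.abstract, Name.fn, GName.fn, h, Finset.erase_eq_of_notMem, Ne.symm h]
  · rfl

theorem Obj.fn_abstract (a z : ℕ) (o : Obj URI Lit) : (o.abstract a z).fn = o.fn.erase a := by
  cases o <;> simp [Obj.abstract, Obj.fn, Name.fn_abstract]

theorem Triple.fn_abstract (a z : ℕ) (C : Triple URI Lit) :
    (C.abstract a z).fn = C.fn.erase a := by
  simp [Triple.abstract, Triple.fn, Name.fn_abstract, Obj.fn_abstract, Finset.erase_union_distrib]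

theorem Constraint.fn_abstract (a z : ℕ) (φ : Constraint URI Lit Pred) :
    (φ.abstract a z).fn = φ.fn.erase a := by
  induction φ with
  | basic p args =>
    ext b
    simp only [Constraint.abstract, Constraint.mem_fn_basic, Finset.mem_erase, List.mem_map]
    constructor
    · rintro ⟨_, ⟨o, ho, rfl⟩, hb⟩
      rw [Obj.fn_abstract, Finset.mem_erase] at hb
      exact ⟨hb.1, o, ho, hb.2⟩
    · rintro ⟨hb, o, ho, hbo⟩
      exact ⟨_, ⟨o, ho, rfl⟩, by rw [Obj.fn_abstract]; exact Finset.mem_erase.2 ⟨hb, hbo⟩⟩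
  | _ => simp_all [Constraint.abstract, Constraint.fn, Finset.erase_union_distrib]

theorem Term.fn_abstract (a z : ℕ) {k : Kind} (P : Term URI Lit Pred k) :
    (P.abstract a z).fn = P.fn.erase a := by
  induction P <;>
    simp_all [Term.abstract, Term.fn, Triple.fn_abstract, Constraint.fn_abstract,
      Finset.erase_union_distrib]

theorem Term.fn_hide (a : ℕ) (P : Term URI Lit Pred .proc) : (P.hide a).fn = P.fn.erase a := by
  rw [Term.hide, Term.fn, Term.fn_abstract]

theorem Term.mem_fn_hideAll {as : List ℕ} {P : Term URI Lit Pred .proc} {b : ℕ} :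
    b ∈ (P.hideAll as).fn ↔ b ∉ as ∧ b ∈ P.fn := by
  induction as with
  | nil => simp [Term.hideAll]
  | cons a as ih =>
    simp only [Term.hideAll, List.foldr_cons] at ih ⊢
    rw [Term.fn_hide, Finset.mem_erase, ih]
    simp [and_assoc]

theorem Name.fn_subset_subst (σ : ℕ → Option (GName URI)) (n : Name URI) :
    n.fn ⊆ (n.subst σ).fn := by
  cases n <;> simp [Name.subst, Name.fn]

theorem Obj.fn_subset_subst (σ : ℕ → Option (GName URI)) (τ : ℕ → Option Lit)
    (o : Obj URI Lit) : o.fn ⊆ (o.subst σ τ).fn := by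
  cases o <;> simp [Obj.subst, Obj.fn, Name.fn_subset_subst]

theorem Triple.fn_subset_subst (σ : ℕ → Option (GName URI)) (τ : ℕ → Option Lit)
    (C : Triple URI Lit) : C.fn ⊆ (C.subst σ τ).fn :=
  Finset.union_subset_union (Finset.union_subset_union (Name.fn_subset_subst _ _)
    (Name.fn_subset_subst _ _)) (Obj.fn_subset_subst _ _ _)

theorem Constraint.fn_subset_subst (σ : ℕ → Option (GName URI)) (τ : ℕ → Option Lit)
    (φ : Constraint URI Lit Pred) : φ.fn ⊆ (φ.subst σ τ).fn := by
  induction φ with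
  | tt => exact subset_rfl
  | ff => exact subset_rfl
  | or φ ψ h₁ h₂ => exact Finset.union_subset_union h₁ h₂
  | and φ ψ h₁ h₂ => exact Finset.union_subset_union h₁ h₂
  | not φ h => exact h
  | basic p args =>
    intro b hb
    obtain ⟨o, ho, hb⟩ := Constraint.mem_fn_basic.1 hb
    exact Constraint.mem_fn_basic.2
      ⟨_, List.mem_map_of_mem ho, Obj.fn_subset_subst σ τ o hb⟩

/-- Substitution fills variables and never erases a temporary name. This carries freshness from an
instance back to the term. -/
theorem Term.fn_subset_subst (σ : ℕ → Option (GName URI)) (τ : ℕ → Option Lit) {k : Kind}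
    (P : Term URI Lit Pred k) : P.fn ⊆ (P.subst σ τ).fn := by
  induction P generalizing σ τ with
  | ask C => exact Triple.fn_subset_subst σ τ C
  | stored C => exact Triple.fn_subset_subst σ τ C
  | filter φ => exact Constraint.fn_subset_subst σ τ φ
  | choice U V h₁ h₂ => exact Finset.union_subset_union (h₁ _ _) (h₂ _ _)
  | tensor U V h₁ h₂ => exact Finset.union_subset_union (h₁ _ _) (h₂ _ _)
  | andThen U V h₁ h₂ => exact Finset.union_subset_union (h₁ _ _) (h₂ _ _)
  | par U V h₁ h₂ => exact Finset.union_subset_union (h₁ _ _) (h₂ _ _)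
  | selectName z U h => exact h _ _
  | selectLit x U h => exact h _ _
  | iter U h => exact h _ _
  | blank z P h => exact h _ _
  | query U h => exact h _ _
  | nothing => exact subset_rfl

theorem Name.fn_subst_subset {σ : ℕ → Option (GName URI)} {s : Finset ℕ}
    (h : ∀ z m, σ z = some m → m.fn ⊆ s) (n : Name URI) : (n.subst σ).fn ⊆ n.fn ∪ s := by
  cases n with
  | ground n => exact Finset.subset_union_left
  | var z =>
    cases hz : σ z with
    | none => simp [Name.subst, Name.fn, hz]
    | some m => simpa [Name.subst, Name.fn, hz] using h z m hz

theorem Obj.fn_subst_subset {σ : ℕ → Option (GName URI)} {s : Finset ℕ}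
    (h : ∀ z m, σ z = some m → m.fn ⊆ s) (τ : ℕ → Option Lit) (o : Obj URI Lit) :
    (o.subst σ τ).fn ⊆ o.fn ∪ s := by
  cases o with
  | name n => exact Name.fn_subst_subset h n
  | lit v => exact Finset.subset_union_left
  | litVar x => cases hx : τ x <;> simp [Obj.subst, Obj.fn, hx]

theorem Triple.fn_subst_subset {σ : ℕ → Option (GName URI)} {s : Finset ℕ}
    (h : ∀ z m, σ z = some m → m.fn ⊆ s) (τ : ℕ → Option Lit) (C : Triple URI Lit) :
    (C.subst σ τ).fn ⊆ C.fn ∪ s := by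
  have h₁ := Name.fn_subst_subset h C.subj
  have h₂ := Name.fn_subst_subset h C.pred
  have h₃ := Obj.fn_subst_subset h τ C.obj
  simp only [Triple.fn, Triple.subst]
  grind

theorem Constraint.fn_subst_subset {σ : ℕ → Option (GName URI)} {s : Finset ℕ}
    (h : ∀ z m, σ z = some m → m.fn ⊆ s) (τ : ℕ → Option Lit) (φ : Constraint URI Lit Pred) :
    (φ.subst σ τ).fn ⊆ φ.fn ∪ s := by
  induction φ with
  | basic p args =>
    intro b hb
    obtain ⟨_, ho', hb⟩ := Constraint.mem_fn_basic.1 hb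
    obtain ⟨o, ho, rfl⟩ := List.mem_map.1 ho'
    rcases Finset.mem_union.1 (Obj.fn_subst_subset h τ o hb) with hb | hb
    · exact Finset.mem_union_left _ (Constraint.mem_fn_basic.2 ⟨o, ho, hb⟩)
    · exact Finset.mem_union_right _ hb
  | _ =>
    simp only [Constraint.fn, Constraint.subst]
    grind

theorem Term.fn_subst_subset {σ : ℕ → Option (GName URI)} {s : Finset ℕ}
    (h : ∀ z m, σ z = some m → m.fn ⊆ s) (τ : ℕ → Option Lit) {k : Kind}
    (P : Term URI Lit Pred k) : (P.subst σ τ).fn ⊆ P.fn ∪ s := by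
  have hu {σ : ℕ → Option (GName URI)} (h : ∀ z m, σ z = some m → m.fn ⊆ s) (w z : ℕ)
      (m : GName URI) (hm : Function.update σ w none z = some m) : m.fn ⊆ s := by
    by_cases hz : z = w
    · simp [hz] at hm
    · exact h z m (by simpa [hz] using hm)
  induction P generalizing σ τ with
  | ask C => exact Triple.fn_subst_subset h τ C
  | stored C => exact Triple.fn_subst_subset h τ C
  | filter φ => exact Constraint.fn_subst_subset h τ φ
  | selectName w U ih => exact ih (hu h w) τ
  | blank w U ih => exact ih (hu h w) τ
  | selectLit x U ih => exact ih h _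
  | iter U ih => exact ih h τ
  | query U ih => exact ih h τ
  | nothing => simp [Term.subst, Term.fn]
  | choice U V ih₁ ih₂ | tensor U V ih₁ ih₂ | andThen U V ih₁ ih₂ | par U V ih₁ ih₂ =>
    have h₁ := ih₁ h τ
    have h₂ := ih₂ h τ
    simp only [Term.fn, Term.subst]
    grind

theorem Term.fn_substName_subset {k : Kind} (P : Term URI Lit Pred k) (z a : ℕ) :
    (P.substName z (.temp a)).fn ⊆ insert a P.fn := by
  rw [Finset.insert_eq, Finset.union_comm]
  refine Term.fn_subst_subset (fun w m hm => ?_) _ P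
  by_cases hw : w = z
  · simp only [hw, Function.update_self, Option.some.injEq] at hm
    simp [← hm, GName.fn]
  · simp [hw] at hm

/-! ### Composition of substitutions -/

/-- The values of the first substitution are ground, so the second acts only where the first is
undefined. -/
theorem Name.subst_subst (σ σ' : ℕ → Option (GName URI)) (n : Name URI) :
    (n.subst σ).subst σ' = n.subst (fun z => (σ z).or (σ' z)) := by
  cases n with
  | ground n => rfl
  | var z => cases h : σ z <;> simp [Name.subst, h]

theorem Obj.subst_subst (σ σ' : ℕ → Option (GName URI)) (τ τ' : ℕ → Option Lit)
    (o : Obj URI Lit) : (o.subst σ τ).subst σ' τ' =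
      o.subst (fun z => (σ z).or (σ' z)) (fun x => (τ x).or (τ' x)) := by
  cases o with
  | name n => simp [Obj.subst, Name.subst_subst]
  | lit v => rfl
  | litVar x => cases h : τ x <;> simp [Obj.subst, h]

theorem Triple.subst_subst (σ σ' : ℕ → Option (GName URI)) (τ τ' : ℕ → Option Lit)
    (C : Triple URI Lit) : (C.subst σ τ).subst σ' τ' =
      C.subst (fun z => (σ z).or (σ' z)) (fun x => (τ x).or (τ' x)) := by
  simp [Triple.subst, Name.subst_subst, Obj.subst_subst]

theorem Constraint.subst_subst (σ σ' : ℕ → Option (GName URI)) (τ τ' : ℕ → Option Lit)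
    (φ : Constraint URI Lit Pred) : (φ.subst σ τ).subst σ' τ' =
      φ.subst (fun z => (σ z).or (σ' z)) (fun x => (τ x).or (τ' x)) := by
  induction φ <;> simp_all [Constraint.subst, Obj.subst_subst]

theorem or_update_none {A : Type*} (σ σ' : ℕ → Option A) (z : ℕ) :
    (fun w => (Function.update σ z none w).or (Function.update σ' z none w)) =
      Function.update (fun w => (σ w).or (σ' w)) z none := by
  funext w
  by_cases h : w = z <;> simp [Function.update, h]

theorem Term.subst_subst (σ σ' : ℕ → Option (GName URI)) (τ τ' : ℕ → Option Lit) {k : Kind}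
    (P : Term URI Lit Pred k) : (P.subst σ τ).subst σ' τ' =
      P.subst (fun z => (σ z).or (σ' z)) (fun x => (τ x).or (τ' x)) := by
  induction P generalizing σ σ' τ τ' <;>
    simp_all [Term.subst, Triple.subst_subst, Constraint.subst_subst, or_update_none]

/-- An ambient substitution that has passed below a binder of `z`, followed by the opening of that
binder, is one ambient substitution with a new value at `z`. -/
theorem Term.subst_update_none_substName (σ : ℕ → Option (GName URI)) (τ : ℕ → Option Lit) (z : ℕ)
    (n : GName URI) {k : Kind} (P : Term URI Lit Pred k) :
    (P.subst (Function.update σ z none) τ).substName z n =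
      P.subst (Function.update σ z (some n)) τ := by
  rw [Term.substName, Term.subst_subst]
  congr 1
  · funext w
    by_cases h : w = z <;> simp [Function.update, h]
  · simp

theorem Term.subst_update_none_substLit (σ : ℕ → Option (GName URI)) (τ : ℕ → Option Lit) (x : ℕ)
    (v : Lit) {k : Kind} (P : Term URI Lit Pred k) :
    (P.subst σ (Function.update τ x none)).substLit x v =
      P.subst σ (Function.update τ x (some v)) := by
  rw [Term.substLit, Term.subst_subst]
  congr 1
  · simp
  · funext w
    by_cases h : w = x <;> simp [Function.update, h]

theorem Name.subst_none (n : Name URI) : n.subst (fun _ => none) = n := by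
  cases n <;> rfl

theorem Obj.subst_none (o : Obj URI Lit) : o.subst (fun _ => none) (fun _ => none) = o := by
  cases o <;> simp [Obj.subst, Name.subst_none]

theorem Triple.subst_none (C : Triple URI Lit) :
    C.subst (fun _ => none) (fun _ => none) = C := by
  simp [Triple.subst, Name.subst_none, Obj.subst_none]

theorem Constraint.subst_none (φ : Constraint URI Lit Pred) :
    φ.subst (fun _ => none) (fun _ => none) = φ := by
  induction φ with
  | basic p args =>
    rw [Constraint.subst, List.map_congr_left fun o _ => Obj.subst_none o, List.map_id']
  | _ => simp_all [Constraint.subst]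

theorem Term.subst_none {k : Kind} (P : Term URI Lit Pred k) :
    P.subst (fun _ => none) (fun _ => none) = P := by
  have h₁ (z : ℕ) : Function.update (fun _ : ℕ => (none : Option (GName URI))) z none =
      fun _ => none := Function.update_eq_self z _
  have h₂ (x : ℕ) : Function.update (fun _ : ℕ => (none : Option Lit)) x none =
      fun _ => none := Function.update_eq_self x _
  induction P <;> simp_all [Term.subst, Triple.subst_none, Constraint.subst_none]

/-! ### Instantiating the variable that abstracts a temporary name -/

theorem Name.abstract_subst {a b z : ℕ} {n : Name URI} (hz : n.varBound ≤ z)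
    (hb : b ∈ n.fn → b = a) (σ : ℕ → Option (GName URI)) :
    (n.abstract a z).subst (Function.update σ z (some (.temp b))) =
      (n.rename (Equiv.swap a b)).subst σ := by
  rcases n with (u | c) | w
  · rfl
  · by_cases hc : c = a
    · subst hc
      simp [Name.abstract, Name.subst, Name.rename, GName.rename]
    · have hcb : c ≠ b := by
        rintro rfl
        exact hc (hb (by simp [Name.fn, GName.fn]))
      simp [Name.abstract, Name.subst, Name.rename, GName.rename, hc,
        Equiv.swap_apply_of_ne_of_ne hc hcb]
  · have : w ≠ z := by
      simp only [Name.varBound] at hz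
      omega
    simp [Name.abstract, Name.subst, Name.rename, this]

theorem Obj.abstract_subst {a b z : ℕ} {o : Obj URI Lit} (hz : o.varBound ≤ z)
    (hb : b ∈ o.fn → b = a) (σ : ℕ → Option (GName URI)) (τ : ℕ → Option Lit) :
    (o.abstract a z).subst (Function.update σ z (some (.temp b))) τ =
      (o.rename (Equiv.swap a b)).subst σ τ := by
  cases o with
  | name n => simp [Obj.abstract, Obj.subst, Obj.rename, Name.abstract_subst (n := n) hz hb]
  | lit v => rfl
  | litVar x => rfl

theorem Triple.abstract_subst {a b z : ℕ} {C : Triple URI Lit} (hz : C.varBound ≤ z)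
    (hb : b ∈ C.fn → b = a) (σ : ℕ → Option (GName URI)) (τ : ℕ → Option Lit) :
    (C.abstract a z).subst (Function.update σ z (some (.temp b))) τ =
      (C.rename (Equiv.swap a b)).subst σ τ := by
  simp only [Triple.varBound, max_le_iff] at hz
  simp only [Triple.fn, Finset.mem_union] at hb
  simp only [Triple.abstract, Triple.subst, Triple.rename]
  rw [Name.abstract_subst hz.1.1 fun h => hb (.inl (.inl h)),
    Name.abstract_subst hz.1.2 fun h => hb (.inl (.inr h)),
    Obj.abstract_subst hz.2 fun h => hb (.inr h)]

theorem Constraint.abstract_subst {a b z : ℕ} {φ : Constraint URI Lit Pred}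
    (hz : φ.varBound ≤ z) (hb : b ∈ φ.fn → b = a) (σ : ℕ → Option (GName URI))
    (τ : ℕ → Option Lit) :
    (φ.abstract a z).subst (Function.update σ z (some (.temp b))) τ =
      (φ.rename (Equiv.swap a b)).subst σ τ := by
  induction φ with
  | basic p args =>
    simp only [Constraint.abstract, Constraint.subst, Constraint.rename, List.map_map]
    congr 1
    exact List.map_congr_left fun o ho =>
      Obj.abstract_subst (Constraint.varBound_basic_le.1 hz o ho)
        (fun h => hb (Constraint.mem_fn_basic.2 ⟨o, ho, h⟩)) σ τ
  | _ =>
    simp_all [Constraint.abstract, Constraint.subst, Constraint.rename, Constraint.varBound,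
      Constraint.fn]

/-- Sending `a` to `z` and then `z` to `b` renames `a` to `b`; the swap does the same because `b`
does not otherwise occur. The bound on the variables ensures that `z` is new and that no binder of
`P` captures it. The hypothesis on `b` also admits `b = a`. -/
theorem Term.abstract_subst {a b z : ℕ} {k : Kind} {P : Term URI Lit Pred k}
    (hz : P.varBound ≤ z) (hb : b ∈ P.fn → b = a) (σ : ℕ → Option (GName URI))
    (τ : ℕ → Option Lit) :
    (P.abstract a z).subst (Function.update σ z (some (.temp b))) τ =
      (P.rename (Equiv.swap a b)).subst σ τ := by
  induction P generalizing σ τ with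
  | ask C => simp only [Term.abstract, Term.subst, Term.rename, Triple.abstract_subst hz hb]
  | stored C => simp only [Term.abstract, Term.subst, Term.rename, Triple.abstract_subst hz hb]
  | filter φ => simp only [Term.abstract, Term.subst, Term.rename, Constraint.abstract_subst hz hb]
  | selectName w U ih =>
    simp only [Term.varBound, max_le_iff] at hz
    simp only [Term.abstract, Term.subst, Term.rename]
    -- The bound variable satisfies `w + 1 ≤ z`, so it differs from `z` and the two updates commute.
    rw [Function.update_comm (by omega), ih hz.2 hb]
  | blank w U ih =>
    simp only [Term.varBound, max_le_iff] at hz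
    simp only [Term.abstract, Term.subst, Term.rename]
    rw [Function.update_comm (by omega), ih hz.2 hb]
  | _ => simp_all [Term.abstract, Term.subst, Term.rename, Term.varBound, Term.fn]

theorem Term.abstract_substName {a b : ℕ} {P : Term URI Lit Pred .proc} (hb : b ∈ P.fn → b = a) :
    (P.abstract a P.varBound).substName P.varBound (.temp b) = P.rename (Equiv.swap a b) := by
  rw [Term.substName, Term.abstract_subst le_rfl hb, Term.subst_none]

end Renaming

/-! ### Semantics: equivariance, fresh replay of transitions, and the contextual closure. -/

section Transitions

variable {URI Lit Pred : Type*} {β : URI → URI → Prop}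
  {holds : Pred → List (GObj URI Lit) → Prop}

/-! ### Equivariance of transitions and bisimilarity -/

theorem GTriple.Le.rename {C D : GTriple URI Lit} (h : GTriple.Le β C D) (π : Equiv.Perm ℕ) :
    GTriple.Le β (C.rename π) (D.rename π) := by
  have hn {m n : GName URI} (h : GName.Le β m n) : GName.Le β (m.rename π) (n.rename π) := by
    cases h with
    | uri h => exact .uri h
    | temp a => exact .temp _
  have ho {o o' : GObj URI Lit} (h : GObj.Le β o o') : GObj.Le β (o.rename π) (o'.rename π) := by
    cases h with
    | name h => simpa using GObj.Le.name (hn h)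
    | lit v => exact .lit v
  exact ⟨hn h.1, hn h.2.1, ho h.2.2⟩

/-- Negation forces an equivalence into the induction. For basic predicates one direction suffices,
since it can be applied to the inverse permutation. -/
theorem Constraint.sat_rename (hholds : RenamingInvariant holds) (π : Equiv.Perm ℕ)
    (φ : Constraint URI Lit Pred) : (φ.rename π).Sat holds ↔ φ.Sat holds := by
  induction φ with
  | basic p args =>
    have key (ρ : Equiv.Perm ℕ) (args : List (Obj URI Lit))
        (h : (Constraint.basic p args).Sat holds) :
        (Constraint.basic p (args.map (Obj.rename ρ))).Sat holds := by
      obtain ⟨vs, rfl, h⟩ := h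
      exact ⟨vs.map (GObj.rename ρ), by simp, (hholds ρ p vs).2 h⟩
    refine ⟨fun h => ?_, key π args⟩
    have := key π⁻¹ _ h
    rwa [List.map_map, show Obj.rename π⁻¹ ∘ Obj.rename π = (id : Obj URI Lit → _) from
      funext (Obj.rename_inv_rename π), List.map_id] at this
  | _ => simp_all [Constraint.rename, Constraint.Sat]

theorem QStep.rename (hholds : RenamingInvariant holds) (π : Equiv.Perm ℕ)
    {U : Term URI Lit Pred .query} {E : Multiset (GTriple URI Lit)} {P : Term URI Lit Pred .proc}
    (h : QStep β holds U E P) :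
    QStep β holds (U.rename π) (E.map (GTriple.rename π)) (P.rename π) := by
  induction h with
  | ask h =>
    rw [Term.rename, ← GTriple.toTriple_rename, Multiset.map_singleton]
    exact .ask (h.rename π)
  | andThen _ ih => exact .andThen ih
  | tensor _ _ ihU ihV =>
    rw [Multiset.map_add]
    exact .tensor ihU ihV
  | choiceLeft _ ih => exact .choiceLeft ih
  | choiceRight _ ih => exact .choiceRight ih
  | filter h => exact .filter ((Constraint.sat_rename hholds π _).2 h)
  | selectName n _ ih => exact .selectName (n.rename π) (by rwa [← Term.rename_substName])
  | selectLit v _ ih => exact .selectLit v (by rwa [← Term.rename_substLit])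
  | weakening => exact .weakening
  | dereliction _ ih => exact .dereliction ih
  | contraction _ ih => exact .contraction ih

theorem toFinset_map_perm (π : Equiv.Perm ℕ) (as : List ℕ) :
    (as.map π).toFinset = as.toFinset.image π := by
  ext
  simp

theorem disjoint_image_perm {s t : Finset ℕ} (h : Disjoint s t) (π : Equiv.Perm ℕ) :
    Disjoint (s.image π) (t.image π) :=
  (Finset.disjoint_image π.injective).2 h

/-- The side conditions on temporary names are all freshness or disjointness conditions, preserved
because `π` is injective. Extruded names are renamed along with the rest of the label. -/
theorem Step.rename (hholds : RenamingInvariant holds) (π : Equiv.Perm ℕ)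
    {P Q : Term URI Lit Pred .proc} {l : Label URI Lit} (h : Step β holds P l Q) :
    Step β holds (P.rename π) (l.rename π) (Q.rename π) := by
  induction h with
  | query h => exact .query (h.rename hholds π)
  | stored h =>
    simp only [Term.rename, ← GTriple.toTriple_rename, Label.rename, Multiset.map_singleton,
      Finset.image_empty]
    exact .stored (h.rename π)
  | openScope hP hα _ ih =>
    simp only [Label.rename, Finset.image_insert]
    refine .openScope (mt Term.mem_fn_rename.1 hP) (by simpa using hα) ?_
    rwa [Term.rename_substName] at ih
  | blankContext hP hl _ ih =>
    rw [Term.rename_hide]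
    refine .blankContext (mt Term.mem_fn_rename.1 hP) (mt Label.mem_names_rename.1 hl) ?_
    rwa [Term.rename_substName] at ih
  | parLeft hQ _ ih =>
    refine .parLeft ?_ ih
    rw [Label.extruded_rename, Term.fn_rename]
    exact disjoint_image_perm hQ π
  | parRight hP _ ih =>
    refine .parRight ?_ ih
    rw [Label.extruded_rename, Term.fn_rename]
    exact disjoint_image_perm hP π
  | parOutputs hα hQ hP _ _ ih₀ ih₁ =>
    simp only [Label.rename, Finset.image_union, Multiset.map_add] at ih₀ ih₁ ⊢
    refine .parOutputs (disjoint_image_perm hα π) ?_ ?_ ih₀ ih₁ <;> rw [Term.fn_rename]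
    exacts [disjoint_image_perm hQ π, disjoint_image_perm hP π]
  | closeLeft has hα _ _ ih₀ ih₁ =>
    simp only [Label.rename, Multiset.map_add, ← toFinset_map_perm] at ih₀ ih₁ ⊢
    rw [Term.rename_hideAll]
    refine .closeLeft (has.map π.injective) ?_ ih₀ ih₁
    simpa [Term.fn_rename, mem_namesOf_rename] using hα
  | closeRight has hα _ _ ih₀ ih₁ =>
    simp only [Label.rename, Multiset.map_add, ← toFinset_map_perm] at ih₀ ih₁ ⊢
    rw [Term.rename_hideAll]
    refine .closeRight (has.map π.injective) ?_ ih₀ ih₁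
    simpa [Term.fn_rename, mem_namesOf_rename] using hα

/-- A bisimulation transported along `π` is again one: pull a transition back along `π⁻¹`, match it
there, and push the answer forward. -/
theorem ClosedBisimilar.rename (hholds : RenamingInvariant holds) (π : Equiv.Perm ℕ)
    {P Q : Term URI Lit Pred .proc} (h : ClosedBisimilar β holds P Q) :
    ClosedBisimilar β holds (P.rename π) (Q.rename π) := by
  obtain ⟨R, ⟨hsymm, hR⟩, hPQ⟩ := h
  refine ⟨fun P Q => R (P.rename π⁻¹) (Q.rename π⁻¹), ⟨fun P Q h => hsymm _ _ h, ?_⟩, ?_⟩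
  · intro P Q h l P' hl hP
    have hl' : Disjoint (l.rename π⁻¹).extruded ((P.rename π⁻¹).fn ∪ (Q.rename π⁻¹).fn) := by
      rw [Label.extruded_rename, Term.fn_rename, Term.fn_rename, ← Finset.image_union]
      exact disjoint_image_perm hl π⁻¹
    obtain ⟨Q', hQ, h'⟩ := hR _ _ h _ _ hl' (hP.rename hholds π⁻¹)
    have hQ := hQ.rename hholds π
    rw [Term.rename_rename_inv, Label.rename_rename_inv] at hQ
    exact ⟨_, hQ, by simpa only [Term.rename_inv_rename] using h'⟩
  · simpa only [Term.rename_inv_rename] using hPQ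

theorem ClosedBisimilar.refl (P : Term URI Lit Pred .proc) : ClosedBisimilar β holds P P := by
  refine ⟨Eq, ⟨fun _ _ h => h.symm, ?_⟩, rfl⟩
  rintro P _ rfl l P' - h
  exact ⟨P', h, rfl⟩

theorem ClosedBisimilar.symm {P Q : Term URI Lit Pred .proc} (h : ClosedBisimilar β holds P Q) :
    ClosedBisimilar β holds Q P := by
  obtain ⟨R, hR, h⟩ := h
  exact ⟨R, hR, hR.1 _ _ h⟩

theorem ClosedBisimilar.exists_step {P Q P' : Term URI Lit Pred .proc} {l : Label URI Lit}
    (h : ClosedBisimilar β holds P Q) (hl : Disjoint l.extruded (P.fn ∪ Q.fn))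
    (hP : Step β holds P l P') : ∃ Q', Step β holds Q l Q' ∧ ClosedBisimilar β holds P' Q' := by
  obtain ⟨R, hR, h⟩ := h
  obtain ⟨Q', hQ, h'⟩ := hR.2 _ _ h l P' hl hP
  exact ⟨Q', hQ, R, hR, h'⟩

/-! ### Fresh choice of the names that a transition extrudes or opens -/

theorem Term.fn_blank_subset_substName (P : Term URI Lit Pred .proc) (z : ℕ) (n : GName URI) :
    (Term.blank z P).fn ⊆ (P.substName z n).fn :=
  Term.fn_subset_subst _ _ P

/-- Each rule that extrudes names requires them to be fresh for the part of the source not covered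
by its premises. The close rules state no freshness for the process that outputs; it is recovered
from here. -/
theorem Step.disjoint_extruded {P Q : Term URI Lit Pred .proc} {l : Label URI Lit}
    (h : Step β holds P l Q) : Disjoint l.extruded P.fn := by
  induction h with
  | openScope hP _ _ ih =>
    simp only [Label.extruded, Finset.disjoint_insert_left] at ih ⊢
    exact ⟨hP, ih.mono_right (Term.fn_blank_subset_substName _ _ _)⟩
  | blankContext _ _ _ ih => exact ih.mono_right (Term.fn_blank_subset_substName _ _ _)
  | parLeft hQ _ ih => exact Finset.disjoint_union_right.2 ⟨ih, hQ⟩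
  | parRight hP _ ih => exact Finset.disjoint_union_right.2 ⟨hP, ih⟩
  | parOutputs _ hQ hP _ _ ih₀ ih₁ =>
    exact Finset.disjoint_union_left.2 ⟨Finset.disjoint_union_right.2 ⟨ih₀, hQ⟩,
      Finset.disjoint_union_right.2 ⟨hP, ih₁⟩⟩
  | _ => exact Finset.disjoint_empty_left _

theorem exists_perm_fresh (S L : Finset ℕ) :
    ∃ π : Equiv.Perm ℕ, (∀ a ∈ S, π a ∉ L) ∧ ∀ b ∈ L, b ∉ S → π b = b := by
  obtain ⟨N, hN⟩ : ∃ N, ∀ a ∈ S ∪ L, a < N :=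
    ⟨(S ∪ L).sup id + 1, fun a ha => Nat.lt_succ_of_le (Finset.le_sup (f := id) ha)⟩
  have hS a (ha : a ∈ S) := hN a (Finset.mem_union_left _ ha)
  have hL a (ha : a ∈ L) := hN a (Finset.mem_union_right _ ha)
  -- Exchange each `a ∈ S` with `a + N`. As `N` exceeds all of `S ∪ L`, the shifted names avoid both
  -- sets, which makes `f` an involution.
  let f (a : ℕ) : ℕ := if a ∈ S then a + N else if N ≤ a ∧ a - N ∈ S then a - N else a
  have hf : Function.Involutive f := by
    intro a
    by_cases h₁ : a ∈ S
    · have : a + N ∉ S := fun h => by have := hS _ h; omega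
      simp [f, h₁, this]
    · by_cases h₂ : N ≤ a ∧ a - N ∈ S
      · simp [f, h₁, h₂]
      · simp [f, h₁, h₂]
  refine ⟨hf.toPerm, fun a ha h => ?_, fun b hb hbS => ?_⟩
  · have := hL _ h
    simp [f, ha] at this
  · have : ¬ N ≤ b := by have := hL b hb; omega
    simp [f, hbS, this]

/-- A communication that closes the scope of the names `as` can be replayed with other names, which
avoid a given finite set, and with the same result. -/
theorem Step.exists_fresh_close (hholds : RenamingInvariant holds)
    {P P' Q Q' : Term URI Lit Pred .proc} {as : List ℕ} {E F : Multiset (GTriple URI Lit)}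
    (has : as.Nodup) (hα : ∀ a ∈ as, a ∉ P.fn ∧ a ∉ namesOf E)
    (h₀ : Step β holds P (.input (E + F)) P') (h₁ : Step β holds Q (.output as.toFinset F) Q')
    (L : Finset ℕ) :
    ∃ (bs : List ℕ) (F' : Multiset (GTriple URI Lit)) (P'' Q'' : Term URI Lit Pred .proc),
      bs.Nodup ∧ (∀ b ∈ bs, b ∉ L ∧ b ∉ namesOf E) ∧
      Step β holds P (.input (E + F')) P'' ∧ Step β holds Q (.output bs.toFinset F') Q'' ∧
      (P'.par Q').hideAll as = (P''.par Q'').hideAll bs ∧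
      (Q'.par P').hideAll as = (Q''.par P'').hideAll bs := by
  -- The set to avoid includes the names of all terms involved and of `E`, so that `π` fixes each of
  -- these names unless it lies in `as`.
  obtain ⟨π, hπ, hfix⟩ := exists_perm_fresh as.toFinset
    (L ∪ P.fn ∪ Q.fn ∪ P'.fn ∪ Q'.fn ∪ (namesOf_finite E).toFinset)
  simp only [Finset.mem_union, List.mem_toFinset, Set.Finite.mem_toFinset, not_or] at hπ hfix
  have hQ : ∀ a ∈ as, a ∉ Q.fn := fun a ha =>
    Finset.disjoint_left.1 h₁.disjoint_extruded (List.mem_toFinset.2 ha)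
  have hPr : P.rename π = P := Term.rename_of_fixed fun a ha =>
    hfix a (by simp [ha]) fun h => (hα a h).1 ha
  have hQr : Q.rename π = Q := Term.rename_of_fixed fun a ha =>
    hfix a (by simp [ha]) fun h => hQ a h ha
  have hEr : E.map (GTriple.rename π) = E := map_rename_of_fixed fun a ha =>
    hfix a (by simp [ha]) fun h => (hα a h).2 ha
  -- After hiding, no name of `as` is free any more, so `π` fixes the whole target. Stating this for
  -- any `X` with these free names serves both orders of the parallel composition.
  have hX (X : Term URI Lit Pred .proc) (hX : X.fn = P'.fn ∪ Q'.fn) :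
      X.hideAll as = (X.rename π).hideAll (as.map π) := by
    rw [← Term.rename_hideAll]
    refine (Term.rename_of_fixed fun a ha => ?_).symm
    rw [Term.mem_fn_hideAll, hX, Finset.mem_union] at ha
    exact hfix a (by tauto) ha.1
  have h₀ := h₀.rename hholds π
  have h₁ := h₁.rename hholds π
  rw [hPr, Label.rename, Multiset.map_add, hEr] at h₀
  rw [hQr, Label.rename, ← toFinset_map_perm] at h₁
  refine ⟨as.map π, _, _, _, has.map π.injective, ?_, h₀, h₁, hX _ rfl,
    hX _ (Finset.union_comm _ _)⟩
  intro b hb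
  obtain ⟨a, ha, rfl⟩ := List.mem_map.1 hb
  have := hπ a ha
  tauto

/-- The opened name is free neither in `P`, nor in the label, nor in the hidden target, so a
permutation that moves it away from `L` can leave all three unchanged. -/
theorem Step.exists_fresh_blankContext (hholds : RenamingInvariant holds) {z a : ℕ}
    {P Q : Term URI Lit Pred .proc} {l : Label URI Lit} (hP : a ∉ P.fn) (hl : a ∉ l.names)
    (h : Step β holds (P.substName z (.temp a)) l Q) (L : Finset ℕ) :
    ∃ b Q', b ∉ L ∧ b ∉ P.fn ∧ b ∉ l.names ∧ Step β holds (P.substName z (.temp b)) l Q' ∧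
      Q.hide a = Q'.hide b := by
  obtain ⟨π, hπ, hfix⟩ := exists_perm_fresh {a} (L ∪ P.fn ∪ Q.fn ∪ l.names_finite.toFinset)
  simp only [Finset.mem_union, Finset.mem_singleton, Set.Finite.mem_toFinset, not_or,
    forall_eq] at hπ hfix
  have hPr : P.rename π = P := Term.rename_of_fixed fun b hb =>
    hfix b (by simp [hb]) fun h => hP (h ▸ hb)
  have hlr : l.rename π = l := Label.rename_of_fixed fun b hb =>
    hfix b (by simp [hb]) fun h => hl (h ▸ hb)
  have h := h.rename hholds π
  rw [Term.rename_substName, hPr, hlr] at h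
  refine ⟨π a, Q.rename π, hπ.1.1.1, hπ.1.1.2, hπ.2, h, ?_⟩
  rw [← Term.rename_hide]
  refine (Term.rename_of_fixed fun b hb => ?_).symm
  rw [Term.fn_hide, Finset.mem_erase] at hb
  exact hfix b (by simp [hb.2]) hb.1

/-! ### The contextual closure of bisimilarity -/

variable (β holds) in
/-- The contextual closure of bisimilarity.  Bound variables are replaced by ground names and
literals, those of `blank` by fresh temporary names only. -/
inductive Cong : {k : Kind} → Term URI Lit Pred k → Term URI Lit Pred k → Prop where
  | base {k : Kind} {P Q : Term URI Lit Pred k}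
      (h : ClosedBisimilar β holds P.toProc Q.toProc) : Cong P Q
  | choice {U U' V V' : Term URI Lit Pred .query} (hU : Cong U U') (hV : Cong V V') :
      Cong (.choice U V) (.choice U' V')
  | tensor {U U' V V' : Term URI Lit Pred .query} (hU : Cong U U') (hV : Cong V V') :
      Cong (.tensor U V) (.tensor U' V')
  | selectName {z w : ℕ} {U V : Term URI Lit Pred .query}
      (h : ∀ n, Cong (U.substName z n) (V.substName w n)) :
      Cong (.selectName z U) (.selectName w V)
  | selectLit {x y : ℕ} {U V : Term URI Lit Pred .query}
      (h : ∀ v, Cong (U.substLit x v) (V.substLit y v)) :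
      Cong (.selectLit x U) (.selectLit y V)
  | iter {U V : Term URI Lit Pred .query} (h : Cong U V) : Cong (.iter U) (.iter V)
  | andThen {U V : Term URI Lit Pred .query} {P Q : Term URI Lit Pred .proc} (hU : Cong U V)
      (hP : Cong P Q) : Cong (.andThen U P) (.andThen V Q)
  | par {P P' Q Q' : Term URI Lit Pred .proc} (hP : Cong P P') (hQ : Cong Q Q') :
      Cong (.par P Q) (.par P' Q')
  | blank {z w : ℕ} {P Q : Term URI Lit Pred .proc}
      (h : ∀ a ∉ P.fn ∪ Q.fn, Cong (P.substName z (.temp a)) (Q.substName w (.temp a))) :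
      Cong (.blank z P) (.blank w Q)
  | query {U V : Term URI Lit Pred .query} (h : Cong U V) : Cong (.query U) (.query V)

theorem Term.toProc_rename (π : Equiv.Perm ℕ) {k : Kind} (P : Term URI Lit Pred k) :
    (P.rename π).toProc = P.toProc.rename π := by
  cases k <;> rfl

theorem Cong.refl {k : Kind} (P : Term URI Lit Pred k) : Cong β holds P P := .base (.refl _)

theorem Cong.symm {k : Kind} {P Q : Term URI Lit Pred k} (h : Cong β holds P Q) :
    Cong β holds Q P := by
  induction h with
  | base h => exact .base h.symm
  | choice _ _ ihU ihV => exact .choice ihU ihV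
  | tensor _ _ ihU ihV => exact .tensor ihU ihV
  | selectName _ ih => exact .selectName ih
  | selectLit _ ih => exact .selectLit ih
  | iter _ ih => exact .iter ih
  | andThen _ _ ihU ihP => exact .andThen ihU ihP
  | par _ _ ihP ihQ => exact .par ihP ihQ
  | blank _ ih => exact .blank fun a ha => ih a (by rwa [Finset.union_comm])
  | query _ ih => exact .query ih

theorem Cong.rename (hholds : RenamingInvariant holds) {k : Kind} {P Q : Term URI Lit Pred k}
    (h : Cong β holds P Q) (π : Equiv.Perm ℕ) : Cong β holds (P.rename π) (Q.rename π) := by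
  induction h with
  | base h =>
    refine .base ?_
    rw [Term.toProc_rename, Term.toProc_rename]
    exact h.rename hholds π
  | choice _ _ ihU ihV => exact .choice ihU ihV
  | tensor _ _ ihU ihV => exact .tensor ihU ihV
  | selectName _ ih =>
    refine .selectName fun n => ?_
    have hn : (n.rename π⁻¹).rename π = n := by
      rw [GName.rename_rename, mul_inv_cancel]
      exact GName.rename_of_fixed fun _ _ => rfl
    rw [← hn, ← Term.rename_substName, ← Term.rename_substName]
    exact ih _
  | selectLit _ ih =>
    refine .selectLit fun v => ?_
    rw [← Term.rename_substLit, ← Term.rename_substLit]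
    exact ih v
  | iter _ ih => exact .iter ih
  | andThen _ _ ihU ihP => exact .andThen ihU ihP
  | par _ _ ihP ihQ => exact .par ihP ihQ
  | blank _ ih =>
    refine .blank fun a ha => ?_
    obtain ⟨b, rfl⟩ := π.surjective a
    have hb : (GName.temp (π b) : GName URI) = GName.rename π (.temp b) := rfl
    rw [hb, ← Term.rename_substName, ← Term.rename_substName]
    exact ih b (by simpa [Term.fn_rename] using ha)
  | query _ ih => exact .query ih

/-- Instantiating the abstracted name with `b` is a swap, so equivariance of the closure is enough.
The two sides may bind different variables, since `hide` chooses them from each term; this is why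
`Cong.blank` allows `z` and `w` to differ. -/
theorem Cong.hide (hholds : RenamingInvariant holds) {P Q : Term URI Lit Pred .proc}
    (h : Cong β holds P Q) (a : ℕ) : Cong β holds (P.hide a) (Q.hide a) := by
  refine .blank fun b hb => ?_
  simp only [Term.fn_abstract, Finset.mem_union, Finset.mem_erase, not_or, not_and'] at hb
  rw [Term.abstract_substName fun h => not_not.1 (hb.1 h),
    Term.abstract_substName fun h => not_not.1 (hb.2 h)]
  exact h.rename hholds _

theorem Cong.hideAll (hholds : RenamingInvariant holds) {P Q : Term URI Lit Pred .proc}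
    (h : Cong β holds P Q) (as : List ℕ) : Cong β holds (P.hideAll as) (Q.hideAll as) := by
  induction as with
  | nil => exact h
  | cons a as ih => exact ih.hide hholds a

/-! ### The contextual closure is a bisimulation -/

variable (β holds) in
/-- Each transition of `P` that extrudes fresh names only is matched by `Q` up to `Cong`. -/
def Simulates {k : Kind} (P Q : Term URI Lit Pred k) : Prop :=
  ∀ (l : Label URI Lit) (P' : Term URI Lit Pred .proc),
    Disjoint l.extruded (P.toProc.fn ∪ Q.toProc.fn) → Step β holds P.toProc l P' →
      ∃ Q', Step β holds Q.toProc l Q' ∧ Cong β holds P' Q'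

theorem Simulates.exists_qStep {U V : Term URI Lit Pred .query} (h : Simulates β holds U V)
    {E : Multiset (GTriple URI Lit)} {P : Term URI Lit Pred .proc} (hU : QStep β holds U E P) :
    ∃ Q, QStep β holds V E Q ∧ Cong β holds P Q := by
  obtain ⟨Q, hV, hPQ⟩ := h (.input E) P (Finset.disjoint_empty_left _) (.query hU)
  cases hV with
  | query hV => exact ⟨Q, hV, hPQ⟩

theorem Simulates.of_exists_qStep {U V : Term URI Lit Pred .query}
    (h : ∀ E P, QStep β holds U E P → ∃ Q, QStep β holds V E Q ∧ Cong β holds P Q) :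
    Simulates β holds U V := by
  intro l P _ hU
  cases hU with
  | query hU =>
    obtain ⟨Q, hV, hPQ⟩ := h _ _ hU
    exact ⟨Q, .query hV, hPQ⟩

theorem Simulates.iter {U V : Term URI Lit Pred .query} (h : Simulates β holds U V) :
    Simulates β holds (.iter U) (.iter V) := by
  refine .of_exists_qStep fun E P hU => ?_
  -- Contraction passes from `.iter U` to `.tensor (.iter U) (.iter U)`, whose components are again
  -- `.iter U`. Induction on the derivation closes once both shapes of the source are treated
  -- together.
  suffices ∀ X E P, QStep β holds X E P →
      (X = .iter U → ∃ Q, QStep β holds (.iter V) E Q ∧ Cong β holds P Q) ∧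
      (X = .tensor (.iter U) (.iter U) →
        ∃ Q, QStep β holds (.tensor (.iter V) (.iter V)) E Q ∧ Cong β holds P Q) from
    (this _ _ _ hU).1 rfl
  clear hU E P
  intro X E P hX
  induction hX with
  | weakening => exact ⟨fun _ => ⟨_, .weakening, .refl _⟩, nofun⟩
  | dereliction hU =>
    refine ⟨?_, nofun⟩
    rintro ⟨⟩
    obtain ⟨Q, hV, hPQ⟩ := h.exists_qStep hU
    exact ⟨Q, .dereliction hV, hPQ⟩
  | contraction _ ih =>
    refine ⟨?_, nofun⟩
    rintro ⟨⟩
    obtain ⟨Q, hV, hPQ⟩ := ih.2 rfl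
    exact ⟨Q, .contraction hV, hPQ⟩
  | tensor _ _ ih₁ ih₂ =>
    refine ⟨nofun, ?_⟩
    rintro ⟨⟩
    obtain ⟨Q₁, hV₁, h₁⟩ := ih₁.1 rfl
    obtain ⟨Q₂, hV₂, h₂⟩ := ih₂.1 rfl
    exact ⟨_, .tensor hV₁ hV₂, .par h₁ h₂⟩
  | _ => exact ⟨nofun, nofun⟩

/-- Simulation alone would not suffice as hypothesis: a component that stays idle reappears in the
target, where it must be related by `Cong`. -/
theorem Simulates.par (hholds : RenamingInvariant holds) {P₁ P₂ Q₁ Q₂ : Term URI Lit Pred .proc}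
    (h₁ : Cong β holds P₁ Q₁) (h₂ : Cong β holds P₂ Q₂) (ih₁ : Simulates β holds P₁ Q₁)
    (ih₂ : Simulates β holds P₂ Q₂) : Simulates β holds (.par P₁ P₂) (.par Q₁ Q₂) := by
  intro l P' hl hP
  simp only [Term.toProc, Term.fn, Finset.disjoint_union_right] at hl
  obtain ⟨⟨hP₁, hP₂⟩, hQ₁, hQ₂⟩ := hl
  cases hP with
  | parLeft _ h =>
    obtain ⟨Q', hQ, h'⟩ := ih₁ _ _ (Finset.disjoint_union_right.2 ⟨hP₁, hQ₁⟩) h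
    exact ⟨_, .parLeft hQ₂ hQ, .par h' h₂⟩
  | parRight _ h =>
    obtain ⟨Q', hQ, h'⟩ := ih₂ _ _ (Finset.disjoint_union_right.2 ⟨hP₂, hQ₂⟩) h
    exact ⟨_, .parRight hQ₁ hQ, .par h₁ h'⟩
  | parOutputs hα _ _ hs ht =>
    simp only [Label.extruded, Finset.disjoint_union_left] at hP₁ hP₂ hQ₁ hQ₂
    obtain ⟨R₁, hs, h₁⟩ := ih₁ (.output _ _) _ (Finset.disjoint_union_right.2 ⟨hP₁.1, hQ₁.1⟩) hs
    obtain ⟨R₂, ht, h₂⟩ := ih₂ (.output _ _) _ (Finset.disjoint_union_right.2 ⟨hP₂.2, hQ₂.2⟩) ht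
    exact ⟨_, .parOutputs hα hQ₂.1 hQ₁.2 hs ht, .par h₁ h₂⟩
  | closeLeft has hα hs ht =>
    -- The label is an input, so `hl` gives no freshness of the closed names. They must avoid `P₂`
    -- and `Q₂` for the output to be matched, and `Q₁` for the side condition of the close rule on
    -- the matching side.
    obtain ⟨bs, F, P', Q', hbs, hb, hs, ht, heq, -⟩ :=
      Step.exists_fresh_close hholds has hα hs ht (P₂.fn ∪ Q₁.fn ∪ Q₂.fn)
    simp only [Finset.mem_union, not_or] at hb
    rw [heq]
    obtain ⟨R₁, hs, h₁⟩ := ih₁ (.input _) _ (Finset.disjoint_empty_left _) hs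
    obtain ⟨R₂, ht, h₂⟩ := ih₂ _ _ (Finset.disjoint_left.2 fun b hb' => by
      have := hb b (List.mem_toFinset.1 hb')
      simp [Term.toProc, this]) ht
    exact ⟨_, .closeLeft hbs (fun b h => ⟨(hb b h).1.1.2, (hb b h).2⟩) hs ht,
      (Cong.par h₁ h₂).hideAll hholds bs⟩
  | closeRight has hα hs ht =>
    obtain ⟨bs, F, P', Q', hbs, hb, ht, hs, -, heq⟩ :=
      Step.exists_fresh_close hholds has hα ht hs (P₁.fn ∪ Q₁.fn ∪ Q₂.fn)
    simp only [Finset.mem_union, not_or] at hb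
    rw [heq]
    obtain ⟨R₁, hs, h₁⟩ := ih₁ _ _ (Finset.disjoint_left.2 fun b hb' => by
      have := hb b (List.mem_toFinset.1 hb')
      simp [Term.toProc, this]) hs
    obtain ⟨R₂, ht, h₂⟩ := ih₂ (.input _) _ (Finset.disjoint_empty_left _) ht
    exact ⟨_, .closeRight hbs (fun b h => ⟨(hb b h).1.2, (hb b h).2⟩) hs ht,
      (Cong.par h₁ h₂).hideAll hholds bs⟩

theorem Simulates.blank (hholds : RenamingInvariant holds) {z w : ℕ}
    {P Q : Term URI Lit Pred .proc}
    (h : ∀ a ∉ P.fn ∪ Q.fn,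
      Simulates β holds (P.substName z (.temp a)) (Q.substName w (.temp a))) :
    Simulates β holds (.blank z P) (.blank w Q) := by
  -- Opening the quantifiers adds at most the name `a`, so freshness of the extruded names persists
  -- as long as `a` is not one of them.
  have hfn {l : Label URI Lit} {a : ℕ} (hl : Disjoint l.extruded (P.fn ∪ Q.fn))
      (ha : a ∉ l.extruded) : Disjoint l.extruded
        ((P.substName z (.temp a)).fn ∪ (Q.substName w (.temp a)).fn) := by
    have hs := (Finset.disjoint_insert_right.2 ⟨ha, hl⟩)
    refine hs.mono_right (Finset.union_subset ?_ ?_)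
    · exact (Term.fn_substName_subset P z a).trans
        (Finset.insert_subset_insert _ Finset.subset_union_left)
    · exact (Term.fn_substName_subset Q w a).trans
        (Finset.insert_subset_insert _ Finset.subset_union_right)
  intro l P' hl hP
  replace hl : Disjoint l.extruded (P.fn ∪ Q.fn) := hl
  cases hP with
  | openScope _ hα hs =>
    -- Here the opened name is itself extruded, so it is already fresh for both processes.
    simp only [Label.extruded, Finset.disjoint_insert_left] at hl
    obtain ⟨Q', hQ, h'⟩ := h _ hl.1 (.output _ _) _ (hfn hl.2 hα) hs
    exact ⟨Q', .openScope (fun ha => hl.1 (Finset.mem_union_right _ ha)) hα hQ, h'⟩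
  | blankContext ha hal hs =>
    -- Here the opened name does not show on the label and may be free in `Q`, so it has to be
    -- chosen anew.
    obtain ⟨b, P', hbQ, hbP, hbl, hs, heq⟩ := hs.exists_fresh_blankContext hholds ha hal Q.fn
    rw [heq]
    have hbe : b ∉ l.extruded := by
      cases l with
      | input E => exact Finset.notMem_empty _
      | output α E => exact fun h => hbl (Or.inl h)
    obtain ⟨Q', hQ, h'⟩ := h b (by simp [hbP, hbQ]) l P' (hfn hl hbe) hs
    exact ⟨_, .blankContext hbQ hbl hQ, h'.hide hholds b⟩

theorem Cong.simulates (hholds : RenamingInvariant holds) {k : Kind} {P Q : Term URI Lit Pred k}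
    (h : Cong β holds P Q) : Simulates β holds P Q := by
  induction h with
  | base h =>
    intro l P' hl hP
    obtain ⟨Q', hQ, h'⟩ := h.exists_step hl hP
    exact ⟨Q', hQ, .base h'⟩
  | choice _ _ ihU ihV =>
    refine .of_exists_qStep fun E P hs => ?_
    cases hs with
    | choiceLeft hs =>
      obtain ⟨Q, ht, h⟩ := ihU.exists_qStep hs
      exact ⟨Q, .choiceLeft ht, h⟩
    | choiceRight hs =>
      obtain ⟨Q, ht, h⟩ := ihV.exists_qStep hs
      exact ⟨Q, .choiceRight ht, h⟩
  | tensor _ _ ihU ihV =>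
    refine .of_exists_qStep fun E P hs => ?_
    cases hs with
    | tensor hs₁ hs₂ =>
      obtain ⟨Q₁, ht₁, h₁⟩ := ihU.exists_qStep hs₁
      obtain ⟨Q₂, ht₂, h₂⟩ := ihV.exists_qStep hs₂
      exact ⟨_, .tensor ht₁ ht₂, .par h₁ h₂⟩
  | selectName _ ih =>
    refine .of_exists_qStep fun E P hs => ?_
    cases hs with
    | selectName n hs =>
      obtain ⟨Q, ht, h⟩ := (ih n).exists_qStep hs
      exact ⟨Q, .selectName n ht, h⟩
  | selectLit _ ih =>
    refine .of_exists_qStep fun E P hs => ?_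
    cases hs with
    | selectLit v hs =>
      obtain ⟨Q, ht, h⟩ := (ih v).exists_qStep hs
      exact ⟨Q, .selectLit v ht, h⟩
  | iter _ ih => exact ih.iter
  -- The continuation does not move; it is only put in parallel with the target, so its relation by
  -- `Cong` is all that is needed.
  | andThen _ hP ihU _ =>
    refine .of_exists_qStep fun E P hs => ?_
    cases hs with
    | andThen hs =>
      obtain ⟨Q, ht, h⟩ := ihU.exists_qStep hs
      exact ⟨_, .andThen ht, .par h hP⟩
  | par hP hQ ihP ihQ => exact .par hholds hP hQ ihP ihQ
  | blank _ ih => exact .blank hholds ih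
  | query _ ih => exact ih

theorem Cong.closedBisimilar (hholds : RenamingInvariant holds) {k : Kind}
    {P Q : Term URI Lit Pred k} (h : Cong β holds P Q) :
    ClosedBisimilar β holds P.toProc Q.toProc := by
  refine ⟨Cong β holds, ⟨fun _ _ h => h.symm, fun _ _ h => h.simulates hholds⟩, ?_⟩
  cases k with
  | query => exact .query h
  | proc => exact h

/-! ### Contexts -/

/-- The instantiation acts after hiding, so its values may contain `a` itself without being
captured. Twisting `σ` by the inverse swap compensates for this: the opened instance is the swap of
an instance at the twisted `σ`. Hence the hypothesis is required at all instantiations. -/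
theorem Cong.instantiate_hide (hholds : RenamingInvariant holds) {P Q : Term URI Lit Pred .proc}
    (h : ∀ (σ : ℕ → GName URI) (τ : ℕ → Lit),
      Cong β holds (P.instantiate σ τ) (Q.instantiate σ τ))
    (a : ℕ) (σ : ℕ → GName URI) (τ : ℕ → Lit) :
    Cong β holds ((P.hide a).instantiate σ τ) ((Q.hide a).instantiate σ τ) := by
  refine .blank fun b hb => ?_
  rw [Finset.mem_union, not_or] at hb
  have key (X : Term URI Lit Pred .proc)
      (hX : b ∉ ((X.abstract a X.varBound).subst
        (Function.update (fun z => some (σ z)) X.varBound none) (fun x => some (τ x))).fn) :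
      ((X.abstract a X.varBound).subst (Function.update (fun z => some (σ z)) X.varBound none)
        (fun x => some (τ x))).substName X.varBound (.temp b) =
      (X.instantiate (fun z => (σ z).rename (Equiv.swap a b)⁻¹) τ).rename (Equiv.swap a b) := by
    rw [Term.subst_update_none_substName, Term.abstract_subst le_rfl, Term.rename_instantiate]
    · simp only [GName.rename_rename, mul_inv_cancel]
      rw [Term.instantiate]
      congr 1
      funext z
      rw [GName.rename_of_fixed fun _ _ => rfl]
    -- If `b ≠ a` were free in `X`, it would remain free in the abstraction and in its instance,
    -- against the freshness of `b`.
    · intro hbX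
      by_contra hne
      refine hX (Term.fn_subset_subst _ _ _ ?_)
      rw [Term.fn_abstract]
      exact Finset.mem_erase.2 ⟨hne, hbX⟩
  rw [key P hb.1, key Q hb.2]
  exact (h _ τ).rename hholds _

theorem Cong.instantiate_plug (hholds : RenamingInvariant holds) {h k : Kind}
    {P Q : Term URI Lit Pred h} (hPQ : Bisimilar β holds P Q) (C : Ctx URI Lit Pred h k)
    (σ : ℕ → GName URI) (τ : ℕ → Lit) :
    Cong β holds ((C.plug P).instantiate σ τ) ((C.plug Q).instantiate σ τ) := by
  have hσ (σ : ℕ → GName URI) (z : ℕ) (n : GName URI) :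
      Function.update (fun w => some (σ w)) z (some n) =
        fun w => some (Function.update σ z n w) := by
    funext w
    by_cases h : w = z <;> simp [Function.update, h]
  have hτ (τ : ℕ → Lit) (x : ℕ) (v : Lit) :
      Function.update (fun w => some (τ w)) x (some v) =
        fun w => some (Function.update τ x v w) := by
    funext w
    by_cases h : w = x <;> simp [Function.update, h]
  induction C generalizing σ τ with
  | hole => exact .base (hPQ σ τ)
  | choiceLeft C V ih => exact .choice (ih σ τ) (.refl _)
  | choiceRight U C ih => exact .choice (.refl _) (ih σ τ)
  | tensorLeft C V ih => exact .tensor (ih σ τ) (.refl _)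
  | tensorRight U C ih => exact .tensor (.refl _) (ih σ τ)
  | selectName z C ih =>
    refine .selectName fun n => ?_
    rw [Term.subst_update_none_substName, Term.subst_update_none_substName, hσ]
    exact ih _ τ
  | selectLit x C ih =>
    refine .selectLit fun v => ?_
    rw [Term.subst_update_none_substLit, Term.subst_update_none_substLit, hτ]
    exact ih σ _
  | iter C ih => exact .iter (ih σ τ)
  | andThenLeft C P ih => exact .andThen (ih σ τ) (.refl _)
  | andThenRight U C ih => exact .andThen (.refl _) (ih σ τ)
  | parLeft C Q ih => exact .par (ih σ τ) (.refl _)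
  | parRight P C ih => exact .par (.refl _) (ih σ τ)
  | blank z C ih =>
    -- The closure asks for fresh names only, but the induction hypothesis covers every value of the
    -- captured variable.
    refine .blank fun a _ => ?_
    rw [Term.subst_update_none_substName, Term.subst_update_none_substName, hσ]
    exact ih _ τ
  | blankName a C ih => exact Cong.instantiate_hide hholds ih a σ τ
  | query C ih => exact .query (ih σ τ)

end Transitions

end Syndication

theorem mainTheorem2 {URI Lit Pred : Type*} (β : URI → URI → Prop)
    (holds : Pred → List (Syndication.GObj URI Lit) → Prop)
    (hholds : Syndication.RenamingInvariant holds)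
    {h k : Syndication.Kind} (P Q : Syndication.Term URI Lit Pred h)
    (hPQ : Syndication.Bisimilar β holds P Q) (C : Syndication.Ctx URI Lit Pred h k) :
    Syndication.Bisimilar β holds (C.plug P) (C.plug Q) := 
  fun σ τ => (Syndication.Cong.instantiate_plug hholds hPQ C σ τ).closedBisimilar hholds
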